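/- Let $X\subseteq\mathbb C$ be a domain, $z\in X$, $Y=\mathbb P^1\times X$ with homogeneous coordinates $\xi=[\xi_0:\xi_1]$ on $\mathbb P^1$ and coordinate $x$ on $X$. Put $$Q=\{\xi_0+\xi_1x=0\},\qquad P=P_z=\{\xi_0+\xi_1z=0\},\qquad \Phi_z=\frac{\xi_1\,dx}{\xi_0+\xi_1z},\qquad \Psi_z=\frac{(\xi_0\,d\xi_1-\xi_1\,d\xi_0)\wedge dx}{(\xi_0+\xi_1z)^2}.$$ Homology has complex coefficients (smooth singular chains), and $H^k(M,A\cup B)$ denotes relative de Rham cohomology (closed smooth complex-valued forms on $M$ vanishing on the hypersurfaces $A$ and $B$, modulo differentials of such forms). Let $\beta_z\in H_0(Q\cap P)$ be the class of the single point $([-z:1],z)$ of $Q\cap P$, with the sign such that Leray's coboundary satisfies $\delta\beta_z=-\alpha_z$, where $\alpha_z$ is the class of plus or minus a small circle around $z$, lifted to $Q\setminus P$, for which $i^{-1}\int_{\alpha_z}\Phi_z>0$. Let $S\subset Y$ be a smooth hypersurface such that $P,Q,S$ are in general position. Let $p\beta_z$ be the image of $\beta_z$ in $H_0(Q\cap P,S)$,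 let $\partial:H_1(P,Q\cup S)\to H_0(Q\cap P,S)$ be the boundary map (the part in $Q\cap P$ of the boundary of a chain), and let $\operatorname{Res}_{(P,Q\cup S)}:H^2(Y\setminus P,Q\cup S)\to H^1(P,Q\cup S)$ be the relative residue: if a class is represented by a form equal to $\frac{d\eta}{\eta}\wedge\psi+\theta$ near $P$, with $\psi,\theta$ smooth and $\eta=(\xi_0+\xi_1z)/\xi_1$, its residue is the class of $\psi|_P$. For $f$ holomorphic on $X$, Leray's third Cauchy–Fantappiè formula (in dimension $n=1$) reads $$f(z)=\int_\gamma\operatorname{Res}_{(P,Q\cup S)}f\Psi_z\qquad\text{for every }\gamma\in\partial^{-1}(p\beta_z)\subset H_1(P,Q\cup S).\tag{$*$}$$ Now take $X=\mathbb C$, $z=0$, $\eta=\xi_0/\xi_1$, and, for $a\in\mathbb C$, let $S$ be the closure in $Y$ of $\{a\eta+x=1\}$. Then: 1. $S$ is a smooth hypersurface, $P,Q,S$ are in general position, and $S$ contains the $P$-fibre above $x=1$. Any smooth path in $P\cong\mathbb C$ from $1$ to $0$ represents an element $\gamma$ of $\partial^{-1}(p\beta_0)$, and this $\gamma$ is the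 only element of $\partial^{-1}(p\beta_0)$. 2. For every entire function $f$, the class $\operatorname{Res}_{(P,Q\cup S)}f\Psi_0$ is represented by the form $d\bigl(f(x)((a-1)x+1)\bigr)$ on $P\cong\mathbb C$, and $$\int_\gamma\operatorname{Res}_{(P,Q\cup S)}f\Psi_0=f(0)-a\,f(1),$$ so $(*)$ holds for $f$ if and only if $f(0)=f(0)-a\,f(1)$. 3. Formula $(*)$ holds for all entire $f$ if and only if $a=0$; if $a\neq0$, it fails for every entire $f$ with $f(1)\neq0$. Consequently Leray's third formula, asserted for all domains $X\subseteq\mathbb C$, all $z\in X$, all $f$ holomorphic on $X$ and all smooth hypersurfaces $S\subset Y$ such that $P_z,Q,S$ are in general position, is false. -/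

import Mathlib

open Set Filter Topology
open scoped ContDiff LinearAlgebra.Projectivization

namespace Leray

noncomputable section

/-! ### The space `Y = ℙ¹ × X` and its hypersurfaces

Throughout, `X ⊆ ℂ` is a domain (dimension `n = 1`) and `Y = ℙ¹ × X`. -/

/-- Homogeneous coordinates `ξ = (ξ₀, ξ₁)` together with the coordinate `x`. -/
abbrev HomCoord : Type := (Fin 2 → ℂ) × ℂ

/-- The product `ℙ¹ × ℂ`, which contains `Y = ℙ¹ × X`. -/
abbrev ProjTimes : Type := ℙ ℂ (Fin 2 → ℂ) × ℂ

/-- `Y = ℙ¹ × X`. -/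
def spaceY (X : Set ℂ) : Set ProjTimes := {y | y.2 ∈ X}

/-- The pairs `(ξ, x)` with `ξ ≠ 0` and `([ξ], x) ∈ A`. -/
def cone (A : Set ProjTimes) : Set HomCoord :=
  {p | ∃ h : p.1 ≠ 0, (Projectivization.mk ℂ p.1 h, p.2) ∈ A}

/-- `Q = {(ξ, x) ∈ Y : ξ₀ + ξ₁ x = 0}`. -/
def hypQ (X : Set ℂ) : Set ProjTimes := {y ∈ spaceY X | y.1.rep 0 + y.1.rep 1 * y.2 = 0}

/-- `P_z = {(ξ, x) ∈ Y : ξ₀ + ξ₁ z = 0}`. -/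
def hypP (X : Set ℂ) (z : ℂ) : Set ProjTimes := {y ∈ spaceY X | y.1.rep 0 + y.1.rep 1 * z = 0}

/-- The hypersurface `{a η + x = 1}`, `η = ξ₀ / ξ₁`, in `ℙ¹ × ℂ`: it contains the affine curve
`{([ξ], x) : ξ₁ ≠ 0, a ξ₀ + x ξ₁ = ξ₁}`, and for `a = 0`, when it is the full fibre `{x = 1}`, also
the point at infinity of that fibre. (For `a ≠ 0` the affine curve is already closed.) -/
def hypS (a : ℂ) : Set ProjTimes :=
  {y | (y.1.rep 1 ≠ 0 ∧ a * y.1.rep 0 + y.2 * y.1.rep 1 = y.1.rep 1) ∨ (a = 0 ∧ y.2 = 1)}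

/-- `s` is a local holomorphic defining function, with nonzero differential, at the point `p` of
the cone over `A`. -/
def IsLocalDefFun (A : Set ProjTimes) (p : HomCoord) (s : HomCoord → ℂ) : Prop :=
  AnalyticAt ℂ s p ∧ fderiv ℂ s p ≠ 0 ∧ ∀ᶠ q in 𝓝 p, q ∈ cone A ↔ s q = 0

/-- `S` is a smooth complex hypersurface in `Y = ℙ¹ × X`: a relatively closed subset which near each
of its points is the zero set of a holomorphic function with nonzero differential. -/
def IsSmoothHypersurface (X : Set ℂ) (S : Set ProjTimes) : Prop :=
  S ⊆ spaceY X ∧ (∃ C : Set HomCoord, IsClosed C ∧ cone S = cone (spaceY X) ∩ C) ∧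
    ∀ p ∈ cone S, ∃ s, IsLocalDefFun S p s

/-- The hypersurfaces `A i` are in general position: at each point of `Y`, those which pass through
the point have local defining functions with linearly independent differentials there. -/
def InGeneralPosition {ι : Type} (X : Set ℂ) (A : ι → Set ProjTimes) : Prop :=
  ∀ p ∈ cone (spaceY X), ∃ s : ι → HomCoord → ℂ, (∀ i, p ∈ cone (A i) → IsLocalDefFun (A i) p (s i)) ∧
    LinearIndependent ℂ (fun i : {i // p ∈ cone (A i)} => fderiv ℂ (s i) p)

/-! ### Differential forms

A smooth complex-valued form on an open subset `W` of `ℙ¹ × ℂ` is given by its pullback to the cone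
over `W`, that is, by a smooth form there which is invariant under scaling of `ξ` and vanishes
when one of its arguments is tangent to the fibres of `(ξ, x) ↦ ([ξ], x)`. -/

/-- `τ` is a smooth complex-valued `k`-form on `W`. -/
def IsForm {k : ℕ} (W : Set ProjTimes) (τ : HomCoord → HomCoord [⋀^Fin k]→L[ℝ] ℂ) : Prop :=
  ContDiffOn ℝ ∞ τ (cone W) ∧
  (∀ p ∈ cone W, ∀ c : ℂ, c ≠ 0 → ∀ v : Fin k → HomCoord,
    τ (c • p.1, p.2) (fun i => (c • (v i).1, (v i).2)) = τ p v) ∧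
  (∀ p ∈ cone W, ∀ v : Fin k → HomCoord, (∃ i, ∃ c : ℂ, v i = (c • p.1, 0)) → τ p v = 0)

/-- The restriction (pullback) of the form `τ` on `W` to the submanifold `A ∩ W` is zero. -/
def VanishesOn {k : ℕ} (W A : Set ProjTimes) (τ : HomCoord → HomCoord [⋀^Fin k]→L[ℝ] ℂ) : Prop :=
  ∀ p ∈ cone W, p ∈ cone A → ∀ v : Fin k → HomCoord,
    (∀ i, v i ∈ tangentConeAt ℝ (cone A) p) → τ p v = 0

/-- `τ` represents a class in the relative de Rham group `H^k(W, A ∪ B)`: it is a closed smooth form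
on `W` that vanishes on `A` and on `B`. -/
def IsRelCocycle {k : ℕ} (W A B : Set ProjTimes)
    (τ : HomCoord → HomCoord [⋀^Fin k]→L[ℝ] ℂ) : Prop :=
  IsForm W τ ∧ (∀ p ∈ cone W, extDeriv τ p = 0) ∧ VanishesOn W A τ ∧ VanishesOn W B τ

/-- The differential `dξᵢ`. -/
def dxi (i : Fin 2) : HomCoord →L[ℝ] ℂ :=
  (ContinuousLinearMap.proj i).comp (ContinuousLinearMap.fst ℝ (Fin 2 → ℂ) ℂ)

/-- The differential `dx`. -/
def dx : HomCoord →L[ℝ] ℂ := ContinuousLinearMap.snd ℝ (Fin 2 → ℂ) ℂ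

/-- A real-linear functional as an alternating 1-form. -/
def oneForm {V : Type} [NormedAddCommGroup V] [NormedSpace ℝ V] (α : V →L[ℝ] ℂ) :
    V [⋀^Fin 1]→L[ℝ] ℂ :=
  ContinuousAlternatingMap.ofSubsingleton ℝ V ℂ (0 : Fin 1) α

/-- The wedge product `(α ∧ β)(v₀, v₁) = α(v₀) β(v₁) - α(v₁) β(v₀)`. -/
def wedge (α β : HomCoord →L[ℝ] ℂ) : HomCoord [⋀^Fin 2]→L[ℝ] ℂ :=
  ContinuousMultilinearMap.alternatization
    ((ContinuousMultilinearMap.mkPiAlgebra ℝ (Fin 2) ℂ).compContinuousLinearMap ![α, β])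

theorem wedge_apply (α β : HomCoord →L[ℝ] ℂ) (v : Fin 2 → HomCoord) :
    wedge α β v = α (v 0) * β (v 1) - α (v 1) * β (v 0) := by
  have h : (Finset.univ : Finset (Equiv.Perm (Fin 2))) = {1, Equiv.swap 0 1} := by decide
  have h' : (1 : Equiv.Perm (Fin 2)) ≠ Equiv.swap 0 1 := by decide
  simp [wedge, ContinuousMultilinearMap.alternatization_apply_apply, Fin.prod_univ_two, h,
    Finset.sum_pair h', sub_eq_add_neg]

/-- `Φ_z = ω'(ξ) ∧ ω(x) / (ξ·z)ⁿ` for `n = 1`, where `ω'(ξ) = ξ₁` and `ω(x) = dx`. -/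
def formPhi (z : ℂ) (p : HomCoord) : HomCoord [⋀^Fin 1]→L[ℝ] ℂ :=
  (p.1 1 / (p.1 0 + p.1 1 * z)) • oneForm dx

/-- `f Ψ_z`, where `Ψ_z = ω*(ξ) ∧ ω(x) / (ξ·z)ⁿ⁺¹` for `n = 1`, with `ω*(ξ) = ξ₀ dξ₁ - ξ₁ dξ₀` and
`ω(x) = dx`. -/
def formPsi (z : ℂ) (f : ℂ → ℂ) (p : HomCoord) : HomCoord [⋀^Fin 2]→L[ℝ] ℂ :=
  (f p.2 / (p.1 0 + p.1 1 * z) ^ 2) • wedge (p.1 0 • dxi 1 - p.1 1 • dxi 0) dx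

/-! ### Restriction to `P_z` and `Q`

For `n = 1` the projection `Y → X` maps `P_z` and `Q` isomorphically onto `X`; the inverses are
`x ↦ ([-z : 1], x)` and `x ↦ ([-x : 1], x)`. We use `x` as coordinate on `P_z` and on `Q`. -/

/-- `X ≅ P_z`. -/
def toP (z x : ℂ) : HomCoord := (![-z, 1], x)

/-- `X ≅ Q`. -/
def toQ (x : ℂ) : HomCoord := (![-x, 1], x)

/-- `P_z ∩ A` in the coordinate `x` on `P_z`. -/
def traceP (z : ℂ) (A : Set ProjTimes) : Set ℂ := {x | toP z x ∈ cone A}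

/-- The pullback of a form by a parametrization. -/
def pullback {k : ℕ} (u : ℂ → HomCoord) (τ : HomCoord → HomCoord [⋀^Fin k]→L[ℝ] ℂ) (x : ℂ) :
    ℂ [⋀^Fin k]→L[ℝ] ℂ :=
  (τ (u x)).compContinuousLinearMap (fderiv ℝ u x)

/-! ### The relative residue -/

/-- The defining function `(ξ·z) / ξ₁` of `P_z` in the open neighbourhood `{ξ₁ ≠ 0}` of `P_z`. -/
def etaP (z : ℂ) (p : HomCoord) : ℂ := (p.1 0 + p.1 1 * z) / p.1 1

/-- The closed 1-form `ρ` on `P_z ≅ X` represents the class `Res_{(P_z, Q ∪ S)} [φ]` in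
`H¹(P_z, Q ∪ S)`, where `[φ] ∈ H²(Y \ P_z, Q ∪ S)`: the form `φ` is cohomologous, relative to
`Q ∪ S`, to a form that near `P_z` has a simple pole `(dη/η) ∧ ψ + θ` along `P_z`, with smooth `ψ`
and `θ`, and `ρ` is the restriction of `ψ` to `P_z`.
(`P_z ∩ Q` and `P_z ∩ S` are discrete, so that every 1-form on `P_z` vanishes on them.) -/
def IsRelResidue (X : Set ℂ) (z : ℂ) (S : Set ProjTimes)
    (φ : HomCoord → HomCoord [⋀^Fin 2]→L[ℝ] ℂ) (ρ : ℂ → ℂ [⋀^Fin 1]→L[ℝ] ℂ) : Prop :=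
  IsRelCocycle (spaceY X \ hypP X z) (hypQ X) S φ ∧
  (∀ x ∈ X, extDeriv ρ x = 0) ∧
  ∃ σ : HomCoord → HomCoord [⋀^Fin 1]→L[ℝ] ℂ,
    IsForm (spaceY X \ hypP X z) σ ∧
    VanishesOn (spaceY X \ hypP X z) (hypQ X) σ ∧ VanishesOn (spaceY X \ hypP X z) S σ ∧
    ∃ W : Set ProjTimes, IsOpen (cone W) ∧ hypP X z ⊆ W ∧ W ⊆ spaceY X ∧ (∀ p ∈ cone W, p.1 1 ≠ 0) ∧
    ∃ (ψ : HomCoord → HomCoord →L[ℝ] ℂ) (θ : HomCoord → HomCoord [⋀^Fin 2]→L[ℝ] ℂ),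
      IsForm W (fun p => oneForm (ψ p)) ∧ IsForm W θ ∧
      (∀ p ∈ cone (W \ hypP X z),
        φ p + extDeriv σ p = (etaP z p)⁻¹ • wedge (fderiv ℝ (etaP z) p) (ψ p) + θ p) ∧
      ∀ x ∈ X, ρ x = pullback (toP z) (fun p => oneForm (ψ p)) x

/-! ### Smooth singular chains with complex coefficients -/

/-- Singular `k`-simplices in `ℂ` (as plain maps). -/
abbrev Simp (k : ℕ) : Type := stdSimplex ℝ (Fin (k + 1)) → ℂ

/-- Complex linear combinations of singular `k`-simplices. -/
abbrev Chain (k : ℕ) : Type := Simp k →₀ ℂ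

/-- A singular simplex is smooth if it extends to a smooth map of the ambient space. -/
def IsSmoothSimp {k : ℕ} (s : Simp k) : Prop :=
  ∃ F : (Fin (k + 1) → ℝ) → ℂ, ContDiff ℝ ∞ F ∧ ∀ t : stdSimplex ℝ (Fin (k + 1)), s t = F t

/-- The smooth singular `k`-chains in `A`. -/
def chains (A : Set ℂ) (k : ℕ) : Submodule ℂ (Chain k) :=
  Finsupp.supported ℂ ℂ {s : Simp k | IsSmoothSimp s ∧ ∀ t, s t ∈ A}

/-- The boundary operator: the alternating sum of the faces. -/
def boundary (k : ℕ) : Chain (k + 1) →ₗ[ℂ] Chain k :=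
  Finsupp.linearCombination ℂ (fun s : Simp (k + 1) =>
    ∑ i : Fin (k + 2), Finsupp.single (fun t => s (stdSimplex.map (Fin.succAbove i) t))
      ((-1 : ℂ) ^ (i : ℕ)))

/-- The point `(1 - t, t)` of the standard 1-simplex. -/
def edgePoint (t : unitInterval) : stdSimplex ℝ (Fin 2) :=
  ⟨![1 - t, t], by
    refine ⟨fun i => ?_, by simp [Fin.sum_univ_two]⟩
    fin_cases i
    · simpa using t.2.2
    · simpa using t.2.1⟩

/-- A singular 1-simplex as a path on `[0,1]`, from the vertex `0` to the vertex `1`. -/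
def edgePath (s : Simp 1) : ℝ → ℂ :=
  Set.IccExtend (zero_le_one' ℝ) (fun t => s (edgePoint t))

/-- The integral of a 1-form over a 1-chain. -/
def chainIntegral (ρ : ℂ → ℂ [⋀^Fin 1]→L[ℝ] ℂ) (γ : Chain 1) : ℂ :=
  γ.sum fun s w => w * ∫ t in (0 : ℝ)..1, ρ (edgePath s t) ![derivWithin (edgePath s) (Icc 0 1) t]

/-- The constant 0-simplex at `z`. -/
def pointSimp (z : ℂ) : Simp 0 := fun _ => z

/-- The circle of radius `r` about `z`, run through once counterclockwise, as a singular 1-simplex.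
In the coordinate `x` on `Q` this is Leray's coboundary `δ` of the point of `Q ∩ P_z` over `z`. -/
def circleSimp (z : ℂ) (r : ℝ) : Simp 1 :=
  fun t => z + r * Complex.exp (2 * Real.pi * Complex.I * (t.1 1 : ℂ))

/-- The 0-cycle `β` in `Q ∩ P_z` representing `β_z`: it is the fibre over `z`, which for `n = 1` is
one point, so that `β = m · point` with `m = ±1`, and the orientation `m` is given by
`δ β = -α`, where `α = -m · circle` is the generator with `i⁻¹ ∫_α Φ_z > 0`. -/
def IsBeta (X : Set ℂ) (z : ℂ) (β : Chain 0) : Prop :=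
  ∃ r : ℝ, 0 < r ∧ Metric.closedBall z r ⊆ X ∧ ∃ m : ℤ, (m = 1 ∨ m = -1) ∧
    (∃ c : ℝ, 0 < c ∧ Complex.I⁻¹ * chainIntegral (pullback toQ (formPhi z))
      (Finsupp.single (circleSimp z r) (-(m : ℂ))) = c) ∧
    β = Finsupp.single (pointSimp z) (m : ℂ)

/-- `γ` is a relative cycle in `P_z` modulo `Q ∪ S` whose class lies in `∂⁻¹(p β)`, where
`∂ : H₁(P_z, Q ∪ S) → H₀(Q ∩ P_z, S)`: the boundary of `γ` is a chain `b` in `P_z ∩ Q` plus a chain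
in `P_z ∩ S`, and `b` is homologous to `β` in `Q ∩ P_z` modulo `S`. -/
def InBoundaryPreimage (X : Set ℂ) (z : ℂ) (S : Set ProjTimes) (β : Chain 0) (γ : Chain 1) : Prop :=
  γ ∈ chains X 1 ∧
  ∃ b ∈ chains (traceP z (hypQ X)) 0, ∃ s ∈ chains (traceP z S) 0, boundary 0 γ = b + s ∧
    ∃ c ∈ chains (traceP z (hypQ X)) 1, ∃ e ∈ chains (traceP z (hypQ X ∩ S)) 0,
      b - β = boundary 0 c + e

/-- Two relative 1-cycles represent the same class in `H₁(P_z, Q ∪ S)`. -/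
def RelHomologous (X : Set ℂ) (z : ℂ) (S : Set ProjTimes) (γ γ' : Chain 1) : Prop :=
  ∃ c ∈ chains X 2, ∃ q ∈ chains (traceP z (hypQ X)) 1, ∃ s ∈ chains (traceP z S) 1,
    γ - γ' = boundary 1 c + q + s

/-! ### The third Cauchy-Fantappiè formula for `n = 1` -/

/-- The right-hand side `n! / (2πi)ⁿ⁻¹ ∫_γ ρ` for `n = 1`. -/
def thirdRHS (ρ : ℂ → ℂ [⋀^Fin 1]→L[ℝ] ℂ) (γ : Chain 1) : ℂ :=
  ((Nat.factorial 1 : ℂ) / (2 * Real.pi * Complex.I) ^ (1 - 1)) * chainIntegral ρ γ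

/-- The third formula for the data `X, z, S, f`:
`f(z) = n! / (2πi)ⁿ⁻¹ ∫_γ Res_{(P_z, Q ∪ S)} f Ψ_z` for every `γ ∈ ∂⁻¹(p β_z)`. -/
def ThirdFormula (X : Set ℂ) (z : ℂ) (S : Set ProjTimes) (f : ℂ → ℂ) : Prop :=
  ∀ β γ ρ, IsBeta X z β → InBoundaryPreimage X z S β γ → IsRelResidue X z S (formPsi z f) ρ →
    f z = thirdRHS ρ γ

/-- Leray's third formula for `n = 1`, without extra hypotheses on `S`: it holds for all domains
`X ⊆ ℂ`, base points `z`, holomorphic `f` and smooth hypersurfaces `S` in `ℙ¹ × X` such that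
`P_z, Q, S` are in general position. -/
def LerayThirdFormula : Prop :=
  ∀ (X : Set ℂ) (z : ℂ) (S : Set ProjTimes) (f : ℂ → ℂ), IsOpen X → IsConnected X → z ∈ X →
    DifferentiableOn ℂ f X → IsSmoothHypersurface X S →
    InGeneralPosition X ![hypP X z, hypQ X, S] → ThirdFormula X z S f

end

end Leray

open Leray

namespace Leray

/-! Put η = ξ₀/ξ₁. Then f Ψ₀ = -f dη ∧ dx / η² has a double pole along P = {η = 0}, so a residue
appears only after adding dσ, where σ must vanish on Q = {x = -η} and on S = {aη + x = 1}. Near P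
one can take σ = -g dη/η + f (a - 1 - 1/η) dx with g = f(x)((a - 1)x + 1) (`polePrim`, `resPrim`).
The linear factor interpolates the slopes -dx/dη of the two curves, 1 for Q at x = 0 and a for S at
x = 1; vanishing of σ on both forces these values. Then f Ψ₀ + dσ = dη/η ∧ dg
(`formPsi_add_extDeriv_polePrim`), the residue is dg, and a path from 1 to 0 gives g(0) - g(1) =
f(0) - a f(1). The end point on S contributes unless S is the fibre x = 1 (a = 0) or f(1) = 0.

The formula quantifies over every form representing the residue, so the value must not depend on the
choice of σ. For two choices, the difference is integrated over a thin tube around the segment, with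
end circles in S and Q: Stokes gives 0, and radius → 0 turns this into the vanishing of the integral
over the segment (`integral_polar_part_eq_zero`).

On the topological side P ≅ ℂ, Q ∩ P = {0} and S ∩ P = {1}. Hence every γ in question has boundary
[0] - [1] (`InBoundaryPreimage.boundary_eq`), and two of them differ by a boundary because smooth
1-cycles in ℂ bound (`sub_coneChain_boundary_mem`). -/

/-! ### Cones over P, Q and S in homogeneous coordinates. -/

theorem exists_mk_rep_eq (ξ : Fin 2 → ℂ) (h : ξ ≠ 0) :
    ∃ c : ℂ, c ≠ 0 ∧ ∀ i, (Projectivization.mk ℂ ξ h).rep i = c * ξ i := by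
  obtain ⟨c, hc⟩ := Projectivization.exists_smul_eq_mk_rep ℂ ξ h
  exact ⟨c, c.ne_zero, fun i => by rw [← hc]; rfl⟩

theorem mem_cone_spaceY_univ {p : HomCoord} : p ∈ cone (spaceY univ) ↔ p.1 ≠ 0 := by
  simp [cone, spaceY]

theorem mem_cone_hypP {z : ℂ} {p : HomCoord} :
    p ∈ cone (hypP univ z) ↔ p.1 ≠ 0 ∧ p.1 0 + p.1 1 * z = 0 := by
  simp only [cone, hypP, spaceY, mem_univ, true_and, mem_ofPred_eq]
  rw [← exists_prop]
  refine exists_congr fun h => ?_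
  obtain ⟨c, hc, hr⟩ := exists_mk_rep_eq p.1 h
  rw [hr, hr, mul_assoc, ← mul_add, mul_eq_zero, or_iff_right hc]

theorem mem_cone_hypQ {p : HomCoord} :
    p ∈ cone (hypQ univ) ↔ p.1 ≠ 0 ∧ p.1 0 + p.1 1 * p.2 = 0 := by
  simp only [cone, hypQ, spaceY, mem_univ, true_and, mem_ofPred_eq]
  rw [← exists_prop]
  refine exists_congr fun h => ?_
  obtain ⟨c, hc, hr⟩ := exists_mk_rep_eq p.1 h
  rw [hr, hr, mul_assoc, ← mul_add, mul_eq_zero, or_iff_right hc]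

theorem hom_ne_zero_iff {ξ : Fin 2 → ℂ} : ξ ≠ 0 ↔ ξ 0 ≠ 0 ∨ ξ 1 ≠ 0 := by
  rw [Ne, funext_iff, Fin.forall_fin_two]
  simp only [Pi.zero_apply]
  tauto

/-- A global defining function of the hypersurface `hypS a` on its cone. -/
noncomputable def defS (a : ℂ) (p : HomCoord) : ℂ :=
  if a = 0 then p.2 - 1 else a * p.1 0 + (p.2 - 1) * p.1 1

/-- For a = 0 the equation (x - 1) ξ₁ = 0 would add the whole curve ξ₁ = 0, hence the case split in
`defS`. For a ≠ 0 nothing is added: ξ₁ = 0 would force ξ₀ = 0. -/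
theorem mem_cone_hypS {a : ℂ} {p : HomCoord} :
    p ∈ cone (hypS a) ↔ p.1 ≠ 0 ∧ defS a p = 0 := by
  simp only [cone, hypS, mem_ofPred_eq]
  rw [← exists_prop (a := p.1 ≠ 0)]
  refine exists_congr fun h => ?_
  obtain ⟨c, hc, hr⟩ := exists_mk_rep_eq p.1 h
  have e : (a * (c * p.1 0) + p.2 * (c * p.1 1) = c * p.1 1) ↔
      (a * p.1 0 + (p.2 - 1) * p.1 1 = 0) := by
    rw [← sub_eq_zero, show a * (c * p.1 0) + p.2 * (c * p.1 1) - c * p.1 1 =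
      c * (a * p.1 0 + (p.2 - 1) * p.1 1) by ring, mul_eq_zero, or_iff_right hc]
  rw [hr, hr, mul_ne_zero_iff, e, defS]
  split_ifs with ha
  · subst ha
    simp only [zero_mul, zero_add, true_and, mul_eq_zero, sub_eq_zero]
    tauto
  · have := hom_ne_zero_iff.1 h
    constructor
    · rintro (h | h)
      · exact h.2
      · exact absurd h.1 ha
    · intro hs
      refine Or.inl ⟨⟨hc, fun h1 => ?_⟩, hs⟩
      simp [h1, ha] at hs
      tauto

/-! ### Smoothness of S and general position. -/

theorem isOpen_setOf_ne_zero : IsOpen {p : HomCoord | p.1 ≠ 0} :=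
  isOpen_ne_fun continuous_fst continuous_const

/-- The complex differential of a homogeneous coordinate. -/
noncomputable def cxi (i : Fin 2) : HomCoord →L[ℂ] ℂ :=
  (ContinuousLinearMap.proj i).comp (ContinuousLinearMap.fst ℂ (Fin 2 → ℂ) ℂ)

/-- The complex differential of the coordinate `x`. -/
noncomputable def cdx : HomCoord →L[ℂ] ℂ := ContinuousLinearMap.snd ℂ (Fin 2 → ℂ) ℂ

@[simp] theorem cxi_apply (i : Fin 2) (p : HomCoord) : cxi i p = p.1 i := rfl
@[simp] theorem cdx_apply (p : HomCoord) : cdx p = p.2 := rfl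
@[simp] theorem dxi_apply (i : Fin 2) (p : HomCoord) : dxi i p = p.1 i := rfl
@[simp] theorem dx_apply (p : HomCoord) : dx p = p.2 := rfl

theorem hasFDerivAt_xi (i : Fin 2) (p : HomCoord) :
    HasFDerivAt (fun q : HomCoord => q.1 i) (cxi i) p := (cxi i).hasFDerivAt

theorem hasFDerivAt_snd (p : HomCoord) :
    HasFDerivAt (fun q : HomCoord => q.2) cdx p := cdx.hasFDerivAt

theorem analyticAt_xi (i : Fin 2) (p : HomCoord) : AnalyticAt ℂ (fun q : HomCoord => q.1 i) p :=
  (cxi i).analyticAt p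

theorem analyticAt_snd (p : HomCoord) : AnalyticAt ℂ (fun q : HomCoord => q.2) p :=
  cdx.analyticAt p

theorem hasFDerivAt_defP (p : HomCoord) :
    HasFDerivAt (fun q : HomCoord => q.1 0 + q.1 1 * 0) (cxi 0) p := by
  simpa using hasFDerivAt_xi 0 p

theorem hasFDerivAt_defQ (p : HomCoord) :
    HasFDerivAt (fun q : HomCoord => q.1 0 + q.1 1 * q.2)
      (cxi 0 + (p.1 1 • cdx + p.2 • cxi 1)) p :=
  (hasFDerivAt_xi 0 p).add ((hasFDerivAt_xi 1 p).mul (hasFDerivAt_snd p))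

/-- The differential of `defS a`. -/
noncomputable def dDefS (a : ℂ) (p : HomCoord) : HomCoord →L[ℂ] ℂ :=
  if a = 0 then cdx else a • cxi 0 + ((p.2 - 1) • cxi 1 + p.1 1 • cdx)

theorem hasFDerivAt_defS (a : ℂ) (p : HomCoord) : HasFDerivAt (defS a) (dDefS a p) p := by
  unfold defS dDefS
  split_ifs with ha
  · simpa using (hasFDerivAt_snd p).sub_const 1
  · exact ((hasFDerivAt_xi 0 p).const_mul a).add
      (((hasFDerivAt_snd p).sub_const 1).mul (hasFDerivAt_xi 1 p))

theorem analyticAt_defS (a : ℂ) (p : HomCoord) : AnalyticAt ℂ (defS a) p := by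
  unfold defS
  split_ifs with ha
  · exact (analyticAt_snd p).sub analyticAt_const
  · exact (analyticAt_const.mul (analyticAt_xi 0 p)).add
      (((analyticAt_snd p).sub analyticAt_const).mul (analyticAt_xi 1 p))

theorem IsLocalDefFun.of_global {A : Set ProjTimes} {s : HomCoord → ℂ} {p : HomCoord}
    {s' : HomCoord →L[ℂ] ℂ} (hp : p.1 ≠ 0) (ha : AnalyticAt ℂ s p) (hs : HasFDerivAt s s' p)
    (hA : ∀ q, q ∈ cone A ↔ q.1 ≠ 0 ∧ s q = 0) (v : HomCoord) (hv : s' v ≠ 0) :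
    IsLocalDefFun A p s := by
  refine ⟨ha, ?_, ?_⟩
  · rw [hs.fderiv]
    rintro rfl
    exact hv rfl
  · filter_upwards [isOpen_setOf_ne_zero.mem_nhds hp] with q hq
    rw [hA]
    exact and_iff_right hq

theorem isLocalDefFun_hypS {a : ℂ} {p : HomCoord} (hp : p.1 ≠ 0) :
    IsLocalDefFun (hypS a) p (defS a) := by
  by_cases ha : a = 0
  · exact .of_global hp (analyticAt_defS a p) (hasFDerivAt_defS a p) (fun _ => mem_cone_hypS)
      (0, 1) (by simp [dDefS, ha])
  · exact .of_global hp (analyticAt_defS a p) (hasFDerivAt_defS a p) (fun _ => mem_cone_hypS)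
      (![1, 0], 0) (by simp [dDefS, ha])

theorem isSmoothHypersurface_hypS (a : ℂ) : IsSmoothHypersurface univ (hypS a) := by
  refine ⟨fun _ _ => mem_univ _, ⟨{p | defS a p = 0}, ?_, ?_⟩, fun p hp =>
    ⟨_, isLocalDefFun_hypS (mem_cone_hypS.1 hp).1⟩⟩
  · exact isClosed_eq (continuous_iff_continuousAt.2 fun p => (analyticAt_defS a p).continuousAt)
      continuous_const
  · ext p
    rw [mem_cone_hypS, mem_inter_iff, mem_cone_spaceY_univ, mem_ofPred_eq]

/-- A relation among the members satisfying `p` is extended by zero to all indices, which replaces a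
subtype depending on the point by a fixed finite sum. -/
theorem linearIndependent_subtype_of_forall {ι : Type} [Fintype ι] {p : ι → Prop}
    {D : ι → HomCoord →L[ℂ] ℂ}
    (h : ∀ G : ι → ℂ, (∀ i, ¬ p i → G i = 0) → ∑ i, G i • D i = 0 → G = 0) :
    LinearIndependent ℂ (fun i : {i // p i} => D i) := by
  rw [linearIndependent_iff]
  intro l h0
  have hl := h (l.embDomain (Function.Embedding.subtype p)) (fun i hi => ?_) ?_
  · ext i
    rw [← Finsupp.embDomain_apply_self (Function.Embedding.subtype p) l i, hl]
    rfl
  · refine Finsupp.embDomain_of_notMem_range _ _ _ ?_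
    rintro ⟨j, rfl⟩
    exact hi j.2
  · have e := Finsupp.sum_embDomain (v := l) (f := Function.Embedding.subtype p)
      (g := fun i c => c • D i)
    rw [Finsupp.sum_fintype _ _ (fun i => zero_smul ℂ (D i))] at e
    rw [← h0, e, Finsupp.linearCombination_apply]
    rfl

theorem inGeneralPosition_of_forall {ι : Type} [Fintype ι] {X : Set ℂ} {A : ι → Set ProjTimes}
    (h : ∀ p ∈ cone (spaceY X), ∃ s : ι → HomCoord → ℂ,
      (∀ i, p ∈ cone (A i) → IsLocalDefFun (A i) p (s i)) ∧
      ∀ G : ι → ℂ, (∀ i, p ∉ cone (A i) → G i = 0) → ∑ i, G i • fderiv ℂ (s i) p = 0 → G = 0) :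
    InGeneralPosition X A := by
  intro p hp
  obtain ⟨s, hs, hG⟩ := h p hp
  have := linearIndependent_subtype_of_forall (p := fun i => p ∈ cone (A i))
    (D := fun i => fderiv ℂ (s i) p) hG
  exact ⟨s, hs, this⟩

theorem inGeneralPosition_hypS (a : ℂ) :
    InGeneralPosition univ ![hypP univ 0, hypQ univ, hypS a] := by
  refine inGeneralPosition_of_forall fun p hp => ?_
  rw [mem_cone_spaceY_univ] at hp
  refine ⟨![fun q => q.1 0 + q.1 1 * 0, fun q => q.1 0 + q.1 1 * q.2, defS a], ?_, ?_⟩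
  · intro i hi
    fin_cases i
    · exact .of_global hp ((analyticAt_xi 0 p).add ((analyticAt_xi 1 p).mul analyticAt_const))
        (hasFDerivAt_defP p) (fun _ => mem_cone_hypP) (![1, 0], 0) (by simp)
    · exact .of_global hp ((analyticAt_xi 0 p).add ((analyticAt_xi 1 p).mul (analyticAt_snd p)))
        (hasFDerivAt_defQ p) (fun _ => mem_cone_hypQ) (![1, 0], 0) (by simp)
    · exact isLocalDefFun_hypS hp
  · intro G hG hsum
    simp only [Fin.sum_univ_three, Matrix.cons_val_zero, Matrix.cons_val_one, Matrix.cons_val,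
      (hasFDerivAt_defP p).fderiv, (hasFDerivAt_defQ p).fderiv, (hasFDerivAt_defS a p).fderiv]
      at hsum
    have hP := hG 0
    have hQ := hG 1
    have hS := hG 2
    simp only [Matrix.cons_val_zero, Matrix.cons_val_one, Matrix.cons_val, mem_cone_hypP,
      mem_cone_hypQ, mem_cone_hypS, hp, ne_eq, not_false_eq_true, true_and, mul_zero,
      add_zero] at hP hQ hS
    -- The relation is tested on ∂/∂ξ₀, ∂/∂ξ₁ and ∂/∂x. No point lies on all three hypersurfaces: x
    -- = 0 on P ∩ Q and x = 1 on P ∩ S.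
    have h0 := congrArg (fun D : HomCoord →L[ℂ] ℂ => D (![1, 0], 0)) hsum
    have h1 := congrArg (fun D : HomCoord →L[ℂ] ℂ => D (![0, 1], 0)) hsum
    have h2 := congrArg (fun D : HomCoord →L[ℂ] ℂ => D (0, 1)) hsum
    obtain ⟨ξ, x⟩ := p
    have hne := hom_ne_zero_iff.1 hp
    suffices G 0 = 0 ∧ G 1 = 0 ∧ G 2 = 0 by
      refine funext fun i => ?_
      match i with
      | 0 => exact this.1
      | 1 => exact this.2.1
      | 2 => exact this.2.2
    by_cases ha : a = 0
    · subst ha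
      simp [dDefS, defS] at h0 h1 h2 hP hQ hS hne
      clear hG hsum hp
      have hS' : x = 0 → G 2 = 0 := fun hx => hS (by simp [hx])
      grind
    · simp [dDefS, defS, ha] at h0 h1 h2 hP hQ hS hne
      clear hG hsum hp
      grind

/-! ### Traces of Q and S on P. -/

theorem mem_hypS_of_mem_hypP {a : ℂ} {y : ProjTimes} (hy : y ∈ hypP univ 0) (h1 : y.2 = 1) :
    y ∈ hypS a := by
  have h0 : y.1.rep 0 = 0 := by simpa using hy.2
  have := hom_ne_zero_iff.1 y.1.rep_nonzero
  exact Or.inl ⟨by tauto, by simp [h0, h1]⟩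

theorem mem_traceP_hypQ {x : ℂ} : x ∈ traceP 0 (hypQ univ) ↔ x = 0 := by
  simp [traceP, mem_cone_hypQ, toP]

theorem mem_traceP_hypS {a x : ℂ} : x ∈ traceP 0 (hypS a) ↔ x = 1 := by
  simp [traceP, mem_cone_hypS, toP, defS, sub_eq_zero]

theorem cone_mono {A B : Set ProjTimes} (h : A ⊆ B) : cone A ⊆ cone B :=
  fun _ ⟨h0, hA⟩ => ⟨h0, h hA⟩

theorem traceP_hypQ_inter_hypS (a : ℂ) : traceP 0 (hypQ univ ∩ hypS a) = ∅ := by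
  refine eq_empty_of_forall_notMem fun x hx => ?_
  have h0 : x ∈ traceP 0 (hypQ univ) := cone_mono inter_subset_left hx
  have h1 : x ∈ traceP 0 (hypS a) := cone_mono inter_subset_right hx
  rw [mem_traceP_hypQ] at h0
  rw [mem_traceP_hypS] at h1
  exact zero_ne_one (h0.symm.trans h1)

/-! ### Integrals over edges and the sign of β. -/

/-- The singular 1-simplex given by a path parametrized by the second barycentric coordinate. -/
def edge (f : ℝ → ℂ) : Simp 1 := fun t => f (t.1 1)

theorem isSmoothSimp_edge {f : ℝ → ℂ} (hf : ContDiff ℝ ∞ f) : IsSmoothSimp (edge f) :=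
  ⟨fun t => f (t 1), hf.comp (contDiff_apply ℝ ℝ 1), fun _ => rfl⟩

theorem IsSmoothSimp.exists_edge {s : Simp 1} (hs : IsSmoothSimp s) :
    ∃ f : ℝ → ℂ, ContDiff ℝ ∞ f ∧ s = edge f := by
  obtain ⟨F, hF, h⟩ := hs
  refine ⟨fun r => F ![1 - r, r], hF.comp ?_, ?_⟩
  · refine contDiff_pi.2 fun i => ?_
    fin_cases i
    · exact contDiff_const.sub contDiff_id
    · exact contDiff_id
  · ext t
    have ht := t.2.2
    rw [Fin.sum_univ_two] at ht
    rw [h, edge]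
    congr 1
    ext i
    fin_cases i
    · exact eq_sub_of_add_eq ht
    · rfl

@[simp] theorem edge_edgePoint (f : ℝ → ℂ) (t : unitInterval) : edge f (edgePoint t) = f t := rfl

theorem edgePath_edge (f : ℝ → ℂ) {t : ℝ} (ht : t ∈ Icc (0 : ℝ) 1) : edgePath (edge f) t = f t := by
  rw [edgePath, IccExtend_of_mem _ _ ht, edge_edgePoint]

theorem derivWithin_edgePath_edge {f : ℝ → ℂ} (hf : Differentiable ℝ f) {t : ℝ}
    (ht : t ∈ Icc (0 : ℝ) 1) : derivWithin (edgePath (edge f)) (Icc 0 1) t = deriv f t := by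
  rw [derivWithin_congr (fun _ => edgePath_edge f) (edgePath_edge f ht)]
  exact (hf t).derivWithin (uniqueDiffOn_Icc zero_lt_one t ht)

theorem chainIntegral_single_edge (ρ : ℂ → ℂ [⋀^Fin 1]→L[ℝ] ℂ) {f : ℝ → ℂ}
    (hf : Differentiable ℝ f) (w : ℂ) :
    chainIntegral ρ (Finsupp.single (edge f) w) = w * ∫ t in (0 : ℝ)..1, ρ (f t) ![deriv f t] := by
  rw [chainIntegral, Finsupp.sum_single_index (zero_mul _)]
  congr 1
  refine intervalIntegral.integral_congr fun t ht => ?_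
  rw [uIcc_of_le zero_le_one] at ht
  simp only [edgePath_edge f ht, derivWithin_edgePath_edge hf ht]

theorem circleSimp_eq_edge (z : ℂ) (r : ℝ) :
    circleSimp z r = edge fun t => z + r * Complex.exp (2 * Real.pi * Complex.I * t) := rfl

theorem hasFDerivAt_toQ (x : ℂ) : HasFDerivAt (𝕜 := ℝ) toQ
    ((ContinuousLinearMap.pi ![-ContinuousLinearMap.id ℝ ℂ, 0]).prod
      (ContinuousLinearMap.id ℝ ℂ)) x := by
  refine HasFDerivAt.prodMk ?_ (hasFDerivAt_id x)
  refine hasFDerivAt_pi.2 fun i => ?_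
  fin_cases i
  · exact (hasFDerivAt_id x).neg
  · exact hasFDerivAt_const (1 : ℂ) x

theorem pullback_toQ_formPhi (x v : ℂ) : pullback toQ (formPhi 0) x ![v] = -(x⁻¹ * v) := by
  simp [pullback, (hasFDerivAt_toQ x).fderiv, formPhi, oneForm, toQ]

theorem chainIntegral_formPhi_circle {r : ℝ} (hr : 0 < r) (w : ℂ) :
    chainIntegral (pullback toQ (formPhi 0)) (Finsupp.single (circleSimp 0 r) w) =
      -(2 * Real.pi * Complex.I * w) := by
  have hd : ∀ t : ℝ, HasDerivAt
      (fun t : ℝ => (0 : ℂ) + r * Complex.exp (2 * Real.pi * Complex.I * t))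
      (r * (Complex.exp (2 * Real.pi * Complex.I * t) * (2 * Real.pi * Complex.I))) t := by
    intro t
    have h1 : HasDerivAt (fun t : ℝ => 2 * Real.pi * Complex.I * (t : ℂ))
        (2 * Real.pi * Complex.I) t := by
      simpa using (Complex.ofRealCLM.hasDerivAt (x := t)).const_mul (2 * Real.pi * Complex.I)
    exact (h1.cexp.const_mul (r : ℂ)).const_add 0
  rw [circleSimp_eq_edge, chainIntegral_single_edge _ fun t => (hd t).differentiableAt]
  have hr' : (r : ℂ) ≠ 0 := by exact_mod_cast hr.ne'
  have : ∀ t : ℝ, pullback toQ (formPhi 0) (0 + r * Complex.exp (2 * Real.pi * Complex.I * t))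
      ![deriv (fun t : ℝ => (0 : ℂ) + r * Complex.exp (2 * Real.pi * Complex.I * t)) t] =
      -(2 * Real.pi * Complex.I) := by
    intro t
    rw [pullback_toQ_formPhi, (hd t).deriv]
    have := Complex.exp_ne_zero (2 * Real.pi * Complex.I * t)
    field_simp
    ring
  simp only [this, intervalIntegral.integral_const]
  simp
  ring

/-- On Q one has ξ₁/ξ₀ = -1/x, so Φ₀ restricts to -dx/x and -m times the circle has integral 2πi m.
Positivity after division by i leaves m = 1. -/
theorem isBeta_iff {β : Chain 0} : IsBeta univ 0 β ↔ β = Finsupp.single (pointSimp 0) 1 := by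
  constructor
  · rintro ⟨r, hr, -, m, hm, ⟨c, hc, h⟩, rfl⟩
    rw [chainIntegral_formPhi_circle hr] at h
    rcases hm with rfl | rfl
    · simp
    · exfalso
      have h' : ((-(2 * Real.pi) : ℝ) : ℂ) = c := by
        rw [← h]
        push_cast
        field_simp
      have := Complex.ofReal_injective h'
      have := Real.pi_pos
      linarith
  · rintro rfl
    refine ⟨1, one_pos, subset_univ _, 1, Or.inl rfl, ⟨2 * Real.pi, by positivity, ?_⟩, by simp⟩
    rw [chainIntegral_formPhi_circle one_pos]
    push_cast
    field_simp

/-! ### Smooth 1-cycles in ℂ are boundaries. -/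

/-- The boundaries of smooth singular 2-chains in `ℂ`. -/
noncomputable def boundaries : Submodule ℂ (Chain 1) := (chains univ 2).map (boundary 1)

/-- The 1-chain of the path `f`. -/
noncomputable def pathChain (f : ℝ → ℂ) : Chain 1 := Finsupp.single (edge f) 1

theorem single_mem_chains {A : Set ℂ} {k : ℕ} {s : Simp k} (hs : IsSmoothSimp s) (hA : ∀ t, s t ∈ A)
    (w : ℂ) : Finsupp.single s w ∈ chains A k :=
  Finsupp.single_mem_supported ℂ w ⟨hs, hA⟩

theorem boundary_single {k : ℕ} (s : Simp (k + 1)) (w : ℂ) :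
    boundary k (Finsupp.single s w) = w • ∑ i : Fin (k + 2),
      Finsupp.single (fun t => s (stdSimplex.map (Fin.succAbove i) t)) ((-1 : ℂ) ^ (i : ℕ)) := by
  rw [boundary, Finsupp.linearCombination_single]

/-- The three terms are the faces of the 2-simplex (t₀, t₁, t₂) ↦ G(t₁, t₂). Triangles given by
globally smooth G avoid the usual cone over a path, which need not be smooth at its vertex. -/
theorem triangle_mem_boundaries {G : ℝ → ℝ → ℂ} (hG : ContDiff ℝ ∞ fun p : ℝ × ℝ => G p.1 p.2) :
    pathChain (fun t => G (1 - t) t) - pathChain (fun t => G 0 t) + pathChain (fun t => G t 0) ∈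
      boundaries := by
  refine ⟨Finsupp.single (fun t => G (t.1 1) (t.1 2)) 1, single_mem_chains
    ⟨fun t => G (t 1) (t 2), ?_, fun _ => rfl⟩ (fun _ => mem_univ _) 1, ?_⟩
  · exact hG.comp ((contDiff_apply ℝ ℝ (1 : Fin 3)).prodMk (contDiff_apply ℝ ℝ (2 : Fin 3)))
  · have key : ∀ (i : Fin 3) (t : stdSimplex ℝ (Fin 2)) (j : Fin 3),
        (stdSimplex.map (Fin.succAbove i) t).1 j =
          ∑ l : Fin 2, if i.succAbove l = j then t.1 l else 0 := by
      intro i t j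
      change (stdSimplex.map (Fin.succAbove i) t) j = _
      rw [stdSimplex.map_coe, FunOnFinite.linearMap_apply_apply, Finset.sum_filter]
      rfl
    have h0 : ∀ t : stdSimplex ℝ (Fin 2), t.1 0 = 1 - t.1 1 := by
      intro t
      have ht := t.2.2
      rw [Fin.sum_univ_two] at ht
      exact eq_sub_of_add_eq ht
    rw [boundary_single, one_smul, Fin.sum_univ_three]
    simp only [key, Fin.sum_univ_two]
    simp [Fin.succAbove, pathChain, sub_eq_add_neg, h0]
    rfl

theorem pathChain_const_mem (c : ℂ) : pathChain (fun _ => c) ∈ boundaries := by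
  simpa using triangle_mem_boundaries (G := fun _ _ => c) contDiff_const

theorem pathChain_add_mem (c : ℂ) {A B : ℝ → ℂ} (hA : ContDiff ℝ ∞ A) (hB : ContDiff ℝ ∞ B) :
    pathChain (fun t => c + (A t + B t)) - pathChain (fun t => c + (A 1 + B t)) +
      pathChain (fun t => c + (A (1 - t) + B 0)) ∈ boundaries := by
  have := triangle_mem_boundaries (G := fun x y => c + (A (1 - x) + B y)) (contDiff_const.add
    ((hA.comp (contDiff_const.sub contDiff_fst)).add (hB.comp contDiff_snd)))
  simpa using this

theorem pathChain_mul_mem (c : ℂ) {A B : ℝ → ℂ} (hA : ContDiff ℝ ∞ A) (hB : ContDiff ℝ ∞ B) :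
    pathChain (fun t => c + A t * B t) - pathChain (fun t => c + A 1 * B t) +
      pathChain (fun t => c + A (1 - t) * B 0) ∈ boundaries := by
  have := triangle_mem_boundaries (G := fun x y => c + A (1 - x) * B y) (contDiff_const.add
    ((hA.comp (contDiff_const.sub contDiff_fst)).mul (hB.comp contDiff_snd)))
  simpa using this

theorem contDiff_ofReal : ContDiff ℝ ∞ (fun t : ℝ => (t : ℂ)) := Complex.ofRealCLM.contDiff

/-- Write b = tb + (1 - t)b. Modulo boundaries, the sum triangle gives [b] = [tb] + [(1 - t)b]
(`e4`, `e5`), while the product triangles give [tb] = [b] (`e1`) and [(1 - t)b] = [b], both sides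
being minus the reversed loop (`e2`, `e3`). So [b] = 2[b], that is, [b] = 0. -/
theorem pathChain_loop_mem (c : ℂ) {b : ℝ → ℂ} (hb : ContDiff ℝ ∞ b) (h0 : b 0 = 0)
    (h1 : b 1 = 0) : pathChain (fun t => c + b t) ∈ boundaries := by
  have hid := contDiff_ofReal
  have hrev : ContDiff ℝ ∞ (fun t : ℝ => 1 - (t : ℂ)) := contDiff_const.sub hid
  have e0 := pathChain_const_mem c
  have e1 := add_mem (pathChain_mul_mem c hid hb) e0
  have e2 := add_mem (pathChain_mul_mem c hb hrev) e0
  have e3 := add_mem (pathChain_add_mem c hb (contDiff_const (c := (0 : ℂ)))) e0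
  have e4 := pathChain_add_mem c (hb.mul hrev) (hid.mul hb)
  have e5 := add_mem (pathChain_add_mem c (hb.mul hrev) (contDiff_const (c := (0 : ℂ)))) e0
  have e6 : (fun t : ℝ => c + (b t * (1 - (t : ℂ)) + (t : ℂ) * b t)) = fun t => c + b t := by
    ext t
    ring
  rw [e6] at e4
  simp only [h0, h1, zero_mul, mul_zero, add_zero, zero_add, Complex.ofReal_zero, sub_zero,
    Complex.ofReal_one, one_mul, mul_one] at e1 e2 e3 e4 e5
  convert sub_mem (sub_mem e3 e2) (add_mem (sub_mem e4 e5) (sub_mem (sub_mem e1 e0) e0)) using 1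
  abel

/-- The affine path from `p` to `q`. -/
def affinePath (p q : ℂ) (t : ℝ) : ℂ := p + t * (q - p)

theorem contDiff_affinePath (p q : ℂ) : ContDiff ℝ ∞ (affinePath p q) :=
  contDiff_const.add (contDiff_ofReal.mul contDiff_const)

theorem pathChain_sub_affinePath_mem {f : ℝ → ℂ} (hf : ContDiff ℝ ∞ f) :
    pathChain f - pathChain (affinePath (f 0) (f 1)) ∈ boundaries := by
  have hL := contDiff_affinePath (f 0) (f 1)
  have hb : ContDiff ℝ ∞ (fun t => f t - affinePath (f 0) (f 1) t) := hf.sub hL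
  have hb' : ContDiff ℝ ∞ (fun t => f (1 - t) - affinePath (f 0) (f 1) (1 - t)) :=
    hb.comp (contDiff_const.sub contDiff_id)
  have e1 := pathChain_add_mem 0 hb hL
  have a0 : affinePath (f 0) (f 1) 0 = f 0 := by simp [affinePath]
  have a1 : affinePath (f 0) (f 1) 1 = f 1 := by simp [affinePath]
  have e2 := pathChain_loop_mem (f 0) hb' (by simp [a1]) (by simp [a0])
  -- With b = f - L, L the affine path, the sum triangle leaves [f] - [L] plus the loop b(1 - t)
  -- based at f(0).
  simp only [a0, a1, sub_self, sub_add_cancel, zero_add] at e1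
  convert sub_mem e1 e2 using 1
  simp only [add_comm (f 0)]
  exact (add_sub_cancel_right _ _).symm

theorem pathChain_affinePath_mem (p q : ℂ) :
    pathChain (affinePath p q) - pathChain (affinePath 0 q) + pathChain (affinePath 0 p) ∈
      boundaries := by
  have := triangle_mem_boundaries (G := fun x y => x * p + y * q)
    (((contDiff_ofReal.comp contDiff_fst).mul contDiff_const).add
      ((contDiff_ofReal.comp contDiff_snd).mul contDiff_const))
  have h1 : (fun t : ℝ => ((1 - t : ℝ) : ℂ) * p + t * q) = affinePath p q := by
    ext t
    simp only [affinePath]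
    push_cast
    ring
  have h2 : (fun t : ℝ => ((0 : ℝ) : ℂ) * p + t * q) = affinePath 0 q := by
    ext t
    simp [affinePath]
  have h3 : (fun t : ℝ => (t : ℂ) * p + ((0 : ℝ) : ℂ) * q) = affinePath 0 p := by
    ext t
    simp [affinePath]
  rwa [h1, h2, h3] at this

/-- The cone with vertex `0` over a 0-chain. -/
noncomputable def coneChain : Chain 0 →ₗ[ℂ] Chain 1 :=
  Finsupp.linearCombination ℂ fun s : Simp 0 => pathChain (affinePath 0 (s default))

theorem boundary_zero_single (s : Simp 1) (w : ℂ) : boundary 0 (Finsupp.single s w) =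
    Finsupp.single (pointSimp (s (edgePoint 1))) w -
      Finsupp.single (pointSimp (s (edgePoint 0))) w := by
  have key : ∀ (i : Fin 2) (t : stdSimplex ℝ (Fin 1)) (j : Fin 2),
      (stdSimplex.map (Fin.succAbove i) t).1 j = if i.succAbove 0 = j then 1 else 0 := by
    intro i t j
    change (stdSimplex.map (Fin.succAbove i) t) j = _
    rw [stdSimplex.map_coe, FunOnFinite.linearMap_apply_apply, Finset.sum_filter,
      Fin.sum_univ_one]
    simp
  have h0 : ∀ t : stdSimplex ℝ (Fin 1),
      stdSimplex.map (Fin.succAbove (0 : Fin 2)) t = edgePoint 1 := by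
    intro t
    ext j
    change (stdSimplex.map (Fin.succAbove (0 : Fin 2)) t).1 j = _
    rw [key]
    fin_cases j <;> simp [edgePoint] <;> rfl
  have h1 : ∀ t : stdSimplex ℝ (Fin 1),
      stdSimplex.map (Fin.succAbove (1 : Fin 2)) t = edgePoint 0 := by
    intro t
    ext j
    change (stdSimplex.map (Fin.succAbove (1 : Fin 2)) t).1 j = _
    rw [key]
    fin_cases j <;> simp [edgePoint] <;> rfl
  rw [boundary_single, Fin.sum_univ_two]
  simp only [h0, h1]
  simp [sub_eq_add_neg]
  rfl

/-- Each edge is replaced by the segment between its end points, and each segment by the two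
segments joining 0 to these points. -/
theorem sub_coneChain_boundary_mem {γ : Chain 1} (hγ : γ ∈ chains univ 1) :
    γ - coneChain (boundary 0 γ) ∈ boundaries := by
  have h : ∀ s ∈ γ.support, Finsupp.single s (γ s) -
      coneChain (boundary 0 (Finsupp.single s (γ s))) ∈ boundaries := by
    intro s hs
    obtain ⟨f, hf, rfl⟩ := (hγ hs).1.exists_edge
    have := Submodule.smul_mem _ (γ (edge f)) (add_mem (pathChain_sub_affinePath_mem hf)
      (pathChain_affinePath_mem (f 0) (f 1)))
    convert this using 1
    rw [boundary_zero_single, map_sub, coneChain, Finsupp.linearCombination_single,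
      Finsupp.linearCombination_single]
    have e : Finsupp.single (edge f) (γ (edge f)) = γ (edge f) • pathChain f := by
      simp [pathChain]
    rw [e, ← smul_sub, ← smul_sub]
    congr 1
    simp only [pointSimp, edge_edgePoint, Icc.coe_zero, Icc.coe_one]
    abel
  have := Submodule.sum_mem _ h
  rw [Finset.sum_sub_distrib, ← map_sum, ← map_sum] at this
  have e : ∑ s ∈ γ.support, Finsupp.single s (γ s) = γ := γ.sum_single
  rwa [e] at this

theorem eq_single_of_mem_chains_singleton {k : ℕ} {p : ℂ} {c : Chain k} (hc : c ∈ chains {p} k) :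
    c = Finsupp.single (fun _ => p) (c fun _ => p) := by
  ext s
  by_cases hs : s = fun _ => p
  · simp [hs]
  · rw [Finsupp.single_eq_of_ne hs]
    by_contra h
    exact hs (funext fun t => ((hc (Finsupp.mem_support_iff.2 h)).2 t))

theorem boundary_eq_zero_of_mem_chains_singleton {p : ℂ} {c : Chain 1} (hc : c ∈ chains {p} 1) :
    boundary 0 c = 0 := by
  rw [eq_single_of_mem_chains_singleton hc, boundary_zero_single, sub_self]

/-! ### The preimage of pβ under ∂. -/

/-- The augmentation. -/
noncomputable def augmentation : Chain 0 →ₗ[ℂ] ℂ := Finsupp.linearCombination ℂ fun _ => (1 : ℂ)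

theorem augmentation_boundary (c : Chain 1) : augmentation (boundary 0 c) = 0 := by
  induction c using Finsupp.induction_linear with
  | zero => simp
  | add _ _ h h' => rw [map_add, map_add, h, h', add_zero]
  | single s w => simp [boundary_zero_single, augmentation]

/-- Q ∩ P is a point, so `c` has zero boundary, and Q ∩ P ∩ S is empty, so `e` is zero: the part of
the boundary in Q is β itself. The part in S is a multiple of the point 1, and the augmentation
fixes the multiple as -1. -/
theorem InBoundaryPreimage.boundary_eq {a : ℂ} {γ : Chain 1}
    (h : InBoundaryPreimage univ 0 (hypS a) (Finsupp.single (pointSimp 0) 1) γ) :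
    boundary 0 γ = Finsupp.single (pointSimp 0) 1 - Finsupp.single (pointSimp 1) 1 := by
  obtain ⟨hγ, b, hb, s, hs, hbs, c, hc, e, he, hbc⟩ := h
  have hQ : traceP 0 (hypQ univ) = {0} := Set.ext fun _ => mem_traceP_hypQ
  have hS : traceP 0 (hypS a) = {1} := Set.ext fun _ => mem_traceP_hypS
  rw [hQ] at hb hc
  rw [hS] at hs
  rw [traceP_hypQ_inter_hypS] at he
  have he0 : e = 0 := by
    ext t
    by_contra hne
    exact (he (Finsupp.mem_support_iff.2 hne)).2 default
  rw [he0, add_zero, boundary_eq_zero_of_mem_chains_singleton hc, sub_eq_zero] at hbc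
  have haug := augmentation_boundary γ
  rw [eq_single_of_mem_chains_singleton hs, hbc] at hbs
  rw [hbs, map_add, augmentation, Finsupp.linearCombination_single,
    Finsupp.linearCombination_single, smul_eq_mul, smul_eq_mul, mul_one, mul_one] at haug
  rw [hbs, eq_neg_of_add_eq_zero_right haug, Finsupp.single_neg, sub_eq_add_neg]
  rfl

theorem InBoundaryPreimage.relHomologous {a : ℂ} {γ γ' : Chain 1}
    (h : InBoundaryPreimage univ 0 (hypS a) (Finsupp.single (pointSimp 0) 1) γ)
    (h' : InBoundaryPreimage univ 0 (hypS a) (Finsupp.single (pointSimp 0) 1) γ') :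
    RelHomologous univ 0 (hypS a) γ γ' := by
  have h0 := sub_coneChain_boundary_mem (sub_mem h.1 h'.1)
  rw [map_sub, h.boundary_eq, h'.boundary_eq, sub_self, map_zero, sub_zero] at h0
  obtain ⟨c, hc, hcγ⟩ := h0
  exact ⟨c, hc, 0, zero_mem _, 0, zero_mem _, by rw [hcγ, add_zero, add_zero]⟩

theorem inBoundaryPreimage_single {a : ℂ} {s : Simp 1} (hs : IsSmoothSimp s)
    (h0 : s (edgePoint 0) = 1) (h1 : s (edgePoint 1) = 0) :
    InBoundaryPreimage univ 0 (hypS a) (Finsupp.single (pointSimp 0) 1) (Finsupp.single s 1) := by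
  have hp : ∀ p : ℂ, IsSmoothSimp (pointSimp p) := fun p =>
    ⟨fun _ => p, contDiff_const, fun _ => rfl⟩
  refine ⟨single_mem_chains hs (fun _ => mem_univ _) 1, Finsupp.single (pointSimp 0) 1,
    single_mem_chains (hp 0) (fun _ => mem_traceP_hypQ.2 rfl) 1, -Finsupp.single (pointSimp 1) 1,
    neg_mem (single_mem_chains (hp 1) (fun _ => mem_traceP_hypS.2 rfl) 1), ?_, 0, zero_mem _, 0,
    zero_mem _, by simp⟩
  rw [boundary_zero_single, h0, h1, sub_eq_add_neg]

/-! ### The form f Ψ₀ as a relative cocycle. -/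

@[simp] theorem oneForm_apply {V : Type} [NormedAddCommGroup V] [NormedSpace ℝ V] (α : V →L[ℝ] ℂ)
    (v : Fin 1 → V) : oneForm α v = α (v 0) := rfl

theorem contDiff_oneForm {V : Type} [NormedAddCommGroup V] [NormedSpace ℝ V] :
    ContDiff ℝ ∞ (oneForm : (V →L[ℝ] ℂ) → V [⋀^Fin 1]→L[ℝ] ℂ) :=
  (ContinuousAlternatingMap.ofSubsingletonLIE (𝕜 := ℝ) (E := V) (F := ℂ) (0 : Fin 1)).contDiff

theorem extDeriv_one_apply {V : Type} [NormedAddCommGroup V] [NormedSpace ℝ V]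
    {τ : V → V [⋀^Fin 1]→L[ℝ] ℂ} {p : V} (h : DifferentiableAt ℝ τ p) (v : Fin 2 → V) :
    extDeriv τ p v =
      fderiv ℝ (fun q => τ q ![v 1]) p (v 0) - fderiv ℝ (fun q => τ q ![v 0]) p (v 1) := by
  have e0 : Fin.removeNth 0 v = ![v 1] := by
    ext i
    fin_cases i
    rfl
  have e1 : Fin.removeNth 1 v = ![v 0] := by
    ext i
    fin_cases i
    rfl
  rw [extDeriv_apply h, Fin.sum_univ_two, e0, e1]
  simp [sub_eq_add_neg]

theorem extDeriv_two_apply {V : Type} [NormedAddCommGroup V] [NormedSpace ℝ V]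
    {τ : V → V [⋀^Fin 2]→L[ℝ] ℂ} {p : V} (h : DifferentiableAt ℝ τ p) (v : Fin 3 → V) :
    extDeriv τ p v =
      fderiv ℝ (fun q => τ q ![v 1, v 2]) p (v 0) - fderiv ℝ (fun q => τ q ![v 0, v 2]) p (v 1) +
        fderiv ℝ (fun q => τ q ![v 0, v 1]) p (v 2) := by
  have e0 : Fin.removeNth 0 v = ![v 1, v 2] := by
    ext i
    fin_cases i <;> rfl
  have e1 : Fin.removeNth 1 v = ![v 0, v 2] := by
    ext i
    fin_cases i <;> rfl
  have e2 : Fin.removeNth 2 v = ![v 0, v 1] := by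
    ext i
    fin_cases i <;> rfl
  rw [extDeriv_apply h, Fin.sum_univ_three, e0, e1, e2]
  simp [sub_eq_add_neg]

/-- Within the cone over `A` the function `s` is constant, so both `s'` and 0 are derivatives of it
there; such derivatives agree on tangent vectors. -/
theorem eq_zero_of_mem_tangentConeAt {A : Set ProjTimes} {s : HomCoord → ℂ} {s' : HomCoord →L[ℂ] ℂ}
    {p v : HomCoord} (hs : HasFDerivAt s s' p) (hA : ∀ q ∈ cone A, s q = 0) (hp : p ∈ cone A)
    (hv : v ∈ tangentConeAt ℝ (cone A) p) : s' v = 0 := by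
  have h1 : HasFDerivWithinAt s (s'.restrictScalars ℝ) (cone A) p :=
    (hs.restrictScalars ℝ).hasFDerivWithinAt
  have h2 : HasFDerivWithinAt s (0 : HomCoord →L[ℝ] ℂ) (cone A) p :=
    (hasFDerivWithinAt_const (0 : ℂ) p _).congr hA (hA p hp)
  exact h1.unique_on h2 hv

/-- The form `ξ₀ dξ₁ - ξ₁ dξ₀`. -/
noncomputable def omegaStar (p : HomCoord) : HomCoord →L[ℝ] ℂ := p.1 0 • dxi 1 - p.1 1 • dxi 0

theorem omegaStar_apply (p v : HomCoord) : omegaStar p v = p.1 0 * v.1 1 - p.1 1 * v.1 0 := by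
  simp [omegaStar]

/-- Since ξ₀ dξ₁ - ξ₁ dξ₀ = -ξ₁² dη, this is dη = -dx along Q. The analogue along S is a dη = -dx.
-/
theorem omegaStar_of_tangent_hypQ {p v : HomCoord} (hp : p ∈ cone (hypQ univ))
    (hv : v ∈ tangentConeAt ℝ (cone (hypQ univ)) p) : omegaStar p v = p.1 1 ^ 2 * v.2 := by
  have h1 := eq_zero_of_mem_tangentConeAt (hasFDerivAt_defQ p) (fun q hq => (mem_cone_hypQ.1 hq).2)
    hp hv
  have h2 := (mem_cone_hypQ.1 hp).2
  simp at h1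
  rw [omegaStar_apply]
  linear_combination v.1 1 * h2 - p.1 1 * h1

theorem omegaStar_of_tangent_hypS {a : ℂ} {p v : HomCoord} (hp : p ∈ cone (hypS a))
    (hv : v ∈ tangentConeAt ℝ (cone (hypS a)) p) :
    a * omegaStar p v = p.1 1 ^ 2 * v.2 ∧ (a = 0 → v.2 = 0) := by
  have h1 := eq_zero_of_mem_tangentConeAt (hasFDerivAt_defS a p)
    (fun q hq => (mem_cone_hypS.1 hq).2) hp hv
  have h2 := (mem_cone_hypS.1 hp).2
  rw [omegaStar_apply]
  by_cases ha : a = 0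
  · simp [dDefS, ha] at h1
    simp [ha, h1]
  · simp [dDefS, defS, ha] at h1 h2
    refine ⟨?_, fun h => absurd h ha⟩
    linear_combination v.1 1 * h2 - p.1 1 * h1

theorem mem_cone_diff_hypP {p : HomCoord} :
    p ∈ cone (spaceY univ \ hypP univ 0) ↔ p.1 0 ≠ 0 := by
  have h : p ∈ cone (spaceY univ \ hypP univ 0) ↔ p.1 ≠ 0 ∧ p ∉ cone (hypP univ 0) := by
    constructor
    · rintro ⟨h0, h1⟩
      exact ⟨h0, fun ⟨_, h2⟩ => h1.2 h2⟩
    · rintro ⟨h0, h1⟩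
      exact ⟨h0, mem_univ _, fun h2 => h1 ⟨h0, h2⟩⟩
  rw [h, mem_cone_hypP, hom_ne_zero_iff]
  simp only [mul_zero, add_zero]
  tauto

theorem isOpen_setOf_xi_ne_zero (i : Fin 2) : IsOpen {p : HomCoord | p.1 i ≠ 0} :=
  isOpen_ne_fun (by fun_prop) continuous_const

theorem isOpen_cone_diff_hypP : IsOpen (cone (spaceY univ \ hypP univ 0)) := by
  have : cone (spaceY univ \ hypP univ 0) = {p : HomCoord | p.1 0 ≠ 0} :=
    Set.ext fun _ => mem_cone_diff_hypP
  rw [this]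
  exact isOpen_setOf_xi_ne_zero 0

theorem contDiff_xi (i : Fin 2) : ContDiff ℝ ∞ (fun p : HomCoord => p.1 i) := (dxi i).contDiff

theorem contDiff_dx : ContDiff ℝ ∞ (fun p : HomCoord => p.2) := contDiff_snd

theorem contDiff_entire {f : ℂ → ℂ} (hf : Differentiable ℂ f) : ContDiff ℝ ∞ f :=
  (hf.contDiff (n := ∞)).restrict_scalars ℝ

theorem wedge_omegaStar (p : HomCoord) (β : HomCoord →L[ℝ] ℂ) :
    wedge (omegaStar p) β = p.1 0 • wedge (dxi 1) β - p.1 1 • wedge (dxi 0) β := by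
  ext v
  simp [wedge_apply, omegaStar_apply]
  ring

theorem formPsi_apply (f : ℂ → ℂ) (p : HomCoord) (v : Fin 2 → HomCoord) :
    formPsi 0 f p v =
      f p.2 / p.1 0 ^ 2 * (omegaStar p (v 0) * (v 1).2 - omegaStar p (v 1) * (v 0).2) := by
  simp [formPsi, wedge_apply, omegaStar]

theorem isForm_formPsi {f : ℂ → ℂ} (hf : Differentiable ℂ f) :
    IsForm (spaceY univ \ hypP univ 0) (formPsi 0 f) := by
  refine ⟨?_, ?_, ?_⟩
  · have e : formPsi 0 f = fun p : HomCoord => (f p.2 * ((p.1 0) ^ 2)⁻¹) •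
        (p.1 0 • wedge (dxi 1) dx - p.1 1 • wedge (dxi 0) dx) := by
      ext p v
      rw [← wedge_omegaStar]
      simp [formPsi, omegaStar, div_eq_mul_inv]
    rw [e]
    refine ContDiffOn.smul (ContDiffOn.mul ((contDiff_entire hf).comp contDiff_dx).contDiffOn
      (((contDiff_xi 0).pow 2).contDiffOn.inv fun p hp => ?_)) ?_
    · exact pow_ne_zero 2 (mem_cone_diff_hypP.1 hp)
    · exact (((contDiff_xi 0).smul contDiff_const).sub
        ((contDiff_xi 1).smul contDiff_const)).contDiffOn
  · intro p hp c hc v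
    have := mem_cone_diff_hypP.1 hp
    simp only [formPsi_apply, omegaStar_apply, Pi.smul_apply, smul_eq_mul]
    field_simp
  · rintro p hp v ⟨i, c, hi⟩
    rw [formPsi_apply]
    have h1 : omegaStar p (v i) = 0 := by
      rw [hi, omegaStar_apply]
      simp
      ring
    have h2 : (v i).2 = 0 := by rw [hi]
    fin_cases i <;> simp_all

theorem hasFDerivAt_comp_snd {f : ℂ → ℂ} (hf : Differentiable ℂ f) (p : HomCoord) :
    HasFDerivAt (fun q : HomCoord => f q.2) (deriv f p.2 • cdx) p :=
  (hf p.2).hasDerivAt.comp_hasFDerivAt p (hasFDerivAt_snd p)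

theorem hasFDerivAt_inv_xi {p : HomCoord} {i : Fin 2} (hp : p.1 i ≠ 0) :
    HasFDerivAt (fun q : HomCoord => (q.1 i)⁻¹) (-(p.1 i ^ 2)⁻¹ • cxi i) p :=
  (hasDerivAt_inv hp).comp_hasFDerivAt p (hasFDerivAt_xi i p)

theorem differentiableAt_of_isForm {k : ℕ} {W : Set ProjTimes}
    {τ : HomCoord → HomCoord [⋀^Fin k]→L[ℝ] ℂ} (h : IsForm W τ) (hW : IsOpen (cone W))
    {p : HomCoord} (hp : p ∈ cone W) : DifferentiableAt ℝ τ p :=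
  (h.1.contDiffAt (hW.mem_nhds hp)).differentiableAt (by simp)

theorem fderiv_formPsi {f : ℂ → ℂ} (hf : Differentiable ℂ f) {p : HomCoord} (hp : p.1 0 ≠ 0)
    (v w h : HomCoord) : fderiv ℝ (fun q => formPsi 0 f q ![v, w]) p h =
      deriv f p.2 * h.2 / p.1 0 ^ 2 *
        (omegaStar p v * w.2 - omegaStar p w * v.2) -
      2 * f p.2 * h.1 0 / p.1 0 ^ 3 * (omegaStar p v * w.2 - omegaStar p w * v.2) +
      f p.2 / p.1 0 ^ 2 * (omegaStar h v * w.2 - omegaStar h w * v.2) := by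
  have e : (fun q => formPsi 0 f q ![v, w]) = fun q : HomCoord =>
      f q.2 * ((q.1 0)⁻¹ * (q.1 0)⁻¹) * (q.1 0 * (v.1 1 * w.2 - w.1 1 * v.2) -
        q.1 1 * (v.1 0 * w.2 - w.1 0 * v.2)) := by
    ext q
    rw [formPsi_apply]
    simp only [Matrix.cons_val_zero, Matrix.cons_val_one, omegaStar_apply, div_eq_mul_inv]
    ring
  have h1 := ((hasFDerivAt_comp_snd hf p).mul
    ((hasFDerivAt_inv_xi hp).mul (hasFDerivAt_inv_xi hp))).mul
    (((hasFDerivAt_xi 0 p).mul_const (v.1 1 * w.2 - w.1 1 * v.2)).sub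
      ((hasFDerivAt_xi 1 p).mul_const (v.1 0 * w.2 - w.1 0 * v.2)))
  rw [e]
  erw [(h1.restrictScalars ℝ).fderiv]
  simp [omegaStar_apply]
  field_simp
  ring

theorem extDeriv_formPsi {f : ℂ → ℂ} (hf : Differentiable ℂ f) {p : HomCoord} (hp : p.1 0 ≠ 0) :
    extDeriv (formPsi 0 f) p = 0 := by
  ext v
  rw [extDeriv_two_apply (differentiableAt_of_isForm (isForm_formPsi hf) isOpen_cone_diff_hypP
    (mem_cone_diff_hypP.2 hp))]
  simp only [fderiv_formPsi hf hp, omegaStar_apply]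
  change _ = (0 : ℂ)
  field_simp
  ring

/-- Along Q and along S the forms `omegaStar` and dx are proportional, so their wedge product
vanishes. -/
theorem isRelCocycle_formPsi (a : ℂ) {f : ℂ → ℂ} (hf : Differentiable ℂ f) :
    IsRelCocycle (spaceY univ \ hypP univ 0) (hypQ univ) (hypS a) (formPsi 0 f) := by
  refine ⟨isForm_formPsi hf, fun p hp => extDeriv_formPsi hf (mem_cone_diff_hypP.1 hp), ?_, ?_⟩
  · intro p hp hQ v hv
    rw [formPsi_apply, omegaStar_of_tangent_hypQ hQ (hv 0), omegaStar_of_tangent_hypQ hQ (hv 1)]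
    ring
  · intro p hp hS v hv
    have h0 := omegaStar_of_tangent_hypS hS (hv 0)
    have h1 := omegaStar_of_tangent_hypS hS (hv 1)
    rw [formPsi_apply]
    by_cases ha : a = 0
    · rw [h0.2 ha, h1.2 ha]
      ring
    · refine mul_eq_zero_of_right _ ((mul_eq_zero_iff_left ha).1 ?_)
      linear_combination (v 1).2 * h0.1 - (v 0).2 * h1.1

/-! ### Lowering the order of the pole, and the residue. -/

/-- A smooth cutoff function on `ℂ`, zero near the origin and one near infinity. -/
noncomputable def cutoff (w : ℂ) : ℂ := (Real.smoothTransition (Complex.normSq w - 1) : ℝ)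

theorem contDiff_normSq : ContDiff ℝ ∞ (fun w : ℂ => Complex.normSq w) := by
  simp only [Complex.normSq_apply]
  exact (Complex.reCLM.contDiff.mul Complex.reCLM.contDiff).add
    (Complex.imCLM.contDiff.mul Complex.imCLM.contDiff)

theorem contDiff_cutoff : ContDiff ℝ ∞ cutoff :=
  Complex.ofRealCLM.contDiff.comp
    (Real.smoothTransition.contDiff.comp (contDiff_normSq.sub contDiff_const))

theorem cutoff_eq_zero {w : ℂ} (h : Complex.normSq w < 1) : cutoff w = 0 := by
  rw [cutoff, Real.smoothTransition.zero_of_nonpos (by linarith), Complex.ofReal_zero]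

theorem cutoff_eq_one {w : ℂ} (h : 2 < Complex.normSq w) : cutoff w = 1 := by
  rw [cutoff, Real.smoothTransition.one_of_one_le (by linarith), Complex.ofReal_one]

/-- With w = ξ₁/ξ₀ = 1/η this removes the pole of dη/η along the fibre at infinity w = 0, so that
`polePrim` is smooth on all of Y \ P. -/
theorem contDiff_cutoff_mul_inv : ContDiff ℝ ∞ (fun w => cutoff w * w⁻¹) := by
  refine contDiff_iff_contDiffAt.2 fun w => ?_
  by_cases hw : w = 0
  · have : (fun w => cutoff w * w⁻¹) =ᶠ[𝓝 w] fun _ => 0 := by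
      have h : {w : ℂ | Complex.normSq w < 1} ∈ 𝓝 w :=
        (isOpen_lt contDiff_normSq.continuous continuous_const).mem_nhds (by simp [hw])
      filter_upwards [h] with w hw
      rw [cutoff_eq_zero hw, zero_mul]
    exact contDiffAt_const.congr_of_eventuallyEq this
  · exact contDiff_cutoff.contDiffAt.mul (contDiffAt_id.inv hw)

/-- The primitive of the residue of `f Ψ₀`. -/
def resPrim (a : ℂ) (f : ℂ → ℂ) (w : ℂ) : ℂ := f w * ((a - 1) * w + 1)

theorem differentiable_resPrim (a : ℂ) {f : ℂ → ℂ} (hf : Differentiable ℂ f) :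
    Differentiable ℂ (resPrim a f) := by
  unfold resPrim
  fun_prop

/-- A form on the complement of `P₀`, vanishing on `Q` and `S`, whose differential reduces the
double pole of `f Ψ₀` to a simple one. -/
noncomputable def polePrim (a : ℂ) (f : ℂ → ℂ) (p : HomCoord) : HomCoord →L[ℝ] ℂ :=
  (resPrim a f p.2 * (cutoff (p.1 1 * (p.1 0)⁻¹) * (p.1 1 * (p.1 0)⁻¹)⁻¹) * (p.1 0 ^ 2)⁻¹) •
    omegaStar p +
  (cutoff (p.1 1 * (p.1 0)⁻¹) * (f p.2 * (a - 1 - p.1 1 * (p.1 0)⁻¹))) • dx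

theorem polePrim_apply (a : ℂ) (f : ℂ → ℂ) (p v : HomCoord) : polePrim a f p v =
    resPrim a f p.2 * (cutoff (p.1 1 * (p.1 0)⁻¹) * (p.1 1 * (p.1 0)⁻¹)⁻¹) * (p.1 0 ^ 2)⁻¹ *
      omegaStar p v + cutoff (p.1 1 * (p.1 0)⁻¹) * (f p.2 * (a - 1 - p.1 1 * (p.1 0)⁻¹)) * v.2 := by
  simp [polePrim]

theorem contDiff_omegaStar : ContDiff ℝ ∞ omegaStar :=
  ((contDiff_xi 0).smul contDiff_const).sub ((contDiff_xi 1).smul contDiff_const)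

theorem isForm_polePrim (a : ℂ) {f : ℂ → ℂ} (hf : Differentiable ℂ f) :
    IsForm (spaceY univ \ hypP univ 0) (fun p => oneForm (polePrim a f p)) := by
  refine ⟨?_, ?_, ?_⟩
  · refine contDiff_oneForm.comp_contDiffOn ?_
    have hinv : ContDiffOn ℝ ∞ (fun p : HomCoord => (p.1 0)⁻¹)
        (cone (spaceY univ \ hypP univ 0)) :=
      (contDiff_xi 0).contDiffOn.inv fun p hp => mem_cone_diff_hypP.1 hp
    have hinv2 : ContDiffOn ℝ ∞ (fun p : HomCoord => (p.1 0 ^ 2)⁻¹)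
        (cone (spaceY univ \ hypP univ 0)) :=
      ((contDiff_xi 0).pow 2).contDiffOn.inv fun p hp => pow_ne_zero 2 (mem_cone_diff_hypP.1 hp)
    have hu := (contDiff_xi 1).contDiffOn.mul hinv
    have hg := ((contDiff_entire (differentiable_resPrim a hf)).comp contDiff_dx).contDiffOn
      (s := cone (spaceY univ \ hypP univ 0))
    have hf' := ((contDiff_entire hf).comp contDiff_dx).contDiffOn
      (s := cone (spaceY univ \ hypP univ 0))
    exact (((hg.mul (contDiff_cutoff_mul_inv.comp_contDiffOn hu)).mul hinv2).smul
      contDiff_omegaStar.contDiffOn).add (((contDiff_cutoff.comp_contDiffOn hu).mul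
        (hf'.mul (contDiffOn_const.sub hu))).smul contDiffOn_const)
  · intro p hp c hc v
    have := mem_cone_diff_hypP.1 hp
    have hu : (c • p.1) 1 * ((c • p.1) 0)⁻¹ = p.1 1 * (p.1 0)⁻¹ := by
      simp only [Pi.smul_apply, smul_eq_mul]
      field_simp
    simp only [oneForm_apply, polePrim_apply, hu]
    simp only [omegaStar_apply, Pi.smul_apply, smul_eq_mul]
    congr 1
    field_simp
  · rintro p hp v ⟨i, c, hi⟩
    obtain rfl := Subsingleton.elim i 0
    rw [oneForm_apply, polePrim_apply, hi, omegaStar_apply]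
    simp
    right
    ring

theorem vanishesOn_hypQ_polePrim (a : ℂ) (f : ℂ → ℂ) :
    VanishesOn (spaceY univ \ hypP univ 0) (hypQ univ) (fun p => oneForm (polePrim a f p)) := by
  intro p hp hQ v hv
  have h0 := mem_cone_diff_hypP.1 hp
  have h1 := (mem_cone_hypQ.1 hQ).2
  have h2 : p.1 1 ≠ 0 := by
    intro h
    rw [h] at h1
    simp at h1
    exact h0 h1
  have h3 : p.2 = -p.1 0 * (p.1 1)⁻¹ := by
    field_simp
    linear_combination h1
  rw [oneForm_apply, polePrim_apply, omegaStar_of_tangent_hypQ hQ (hv 0), resPrim]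
  -- Only the x in the linear factor of `resPrim` is replaced by -η; the values of f remain a common
  -- factor.
  nth_rewrite 2 [h3]
  field_simp
  ring

theorem vanishesOn_hypS_polePrim (a : ℂ) (f : ℂ → ℂ) :
    VanishesOn (spaceY univ \ hypP univ 0) (hypS a) (fun p => oneForm (polePrim a f p)) := by
  intro p hp hS v hv
  have h0 := mem_cone_diff_hypP.1 hp
  have h1 := (mem_cone_hypS.1 hS).2
  obtain ⟨h2, h3⟩ := omegaStar_of_tangent_hypS hS (hv 0)
  rw [oneForm_apply, polePrim_apply, resPrim]
  by_cases ha : a = 0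
  · have h4 : p.2 = 1 := by simpa [defS, ha, sub_eq_zero] using h1
    rw [h3 ha, h4, ha]
    ring
  · simp only [defS, ha, if_false] at h1
    by_cases hx : p.1 1 = 0
    · simp [hx, ha, h0] at h1
    -- Tangency to S controls only a dη, so the identity is multiplied by a ≠ 0.
    refine (mul_eq_zero_iff_left ha).1 ?_
    have h5 : a = -((p.2 - 1) * p.1 1) * (p.1 0)⁻¹ := by
      field_simp
      linear_combination h1
    calc _ = f p.2 * cutoff (p.1 1 * (p.1 0)⁻¹) *
          (((a - 1) * p.2 + 1) * (p.1 1 * (p.1 0)⁻¹)⁻¹ * (p.1 0 ^ 2)⁻¹ * (a * omegaStar p (v 0)) +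
            a * (a - 1 - p.1 1 * (p.1 0)⁻¹) * (v 0).2) := by ring
      _ = 0 := by
        rw [h2, h5]
        refine mul_eq_zero_of_right _ ?_
        field_simp
        ring

/-- The neighbourhood `{|ξ₁|² > 2 |ξ₀|²}` of `P₀`. -/
def nearP : Set ProjTimes := {y | 2 * Complex.normSq (y.1.rep 0) < Complex.normSq (y.1.rep 1)}

theorem mem_cone_nearP {p : HomCoord} :
    p ∈ cone nearP ↔ 2 * Complex.normSq (p.1 0) < Complex.normSq (p.1 1) := by
  have h0 : 2 * Complex.normSq (p.1 0) < Complex.normSq (p.1 1) → p.1 ≠ 0 := by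
    intro h h0
    simp [h0] at h
  simp only [cone, nearP, mem_ofPred_eq]
  constructor
  · rintro ⟨h, hA⟩
    obtain ⟨c, hc, hr⟩ := exists_mk_rep_eq p.1 h
    rw [hr, hr, Complex.normSq_mul, Complex.normSq_mul, mul_left_comm] at hA
    exact lt_of_mul_lt_mul_left hA (Complex.normSq_nonneg c)
  · intro hA
    obtain ⟨c, hc, hr⟩ := exists_mk_rep_eq p.1 (h0 hA)
    refine ⟨h0 hA, ?_⟩
    rw [hr, hr, Complex.normSq_mul, Complex.normSq_mul, mul_left_comm]
    exact mul_lt_mul_of_pos_left hA (Complex.normSq_pos.2 hc)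

theorem isOpen_cone_nearP : IsOpen (cone nearP) := by
  have : cone nearP = {p : HomCoord | 2 * Complex.normSq (p.1 0) < Complex.normSq (p.1 1)} :=
    Set.ext fun _ => mem_cone_nearP
  rw [this]
  exact isOpen_lt
    (continuous_const.mul (contDiff_normSq.continuous.comp (contDiff_xi 0).continuous))
    (contDiff_normSq.continuous.comp (contDiff_xi 1).continuous)

theorem hypP_subset_nearP : hypP univ 0 ⊆ nearP := by
  intro y hy
  have h0 : y.1.rep 0 = 0 := by simpa using hy.2
  have h1 := hom_ne_zero_iff.1 y.1.rep_nonzero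
  have h2 : y.1.rep 1 ≠ 0 := by tauto
  rw [nearP, mem_ofPred_eq, h0]
  simpa using h2

theorem xi_one_ne_zero_of_mem_cone_nearP {p : HomCoord} (hp : p ∈ cone nearP) : p.1 1 ≠ 0 := by
  intro h
  rw [mem_cone_nearP, h, map_zero] at hp
  linarith [Complex.normSq_nonneg (p.1 0)]

/-- On `nearP` one has |ξ₁/ξ₀|² > 2, so the cutoff is 1 and the form is -g dη/η + f (a - 1 - 1/η) dx
with g = `resPrim a f`. -/
theorem polePrim_apply_of_mem_nearP (a : ℂ) (f : ℂ → ℂ) {q : HomCoord} (h0 : q.1 0 ≠ 0)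
    (hq : q ∈ cone nearP) (w : HomCoord) : polePrim a f q w =
      resPrim a f q.2 * ((q.1 1)⁻¹ * w.1 1 - (q.1 0)⁻¹ * w.1 0) +
        f q.2 * (a - 1 - q.1 1 * (q.1 0)⁻¹) * w.2 := by
  have h1 := xi_one_ne_zero_of_mem_cone_nearP hq
  rw [polePrim_apply, cutoff_eq_one, omegaStar_apply]
  · field_simp
  · rw [Complex.normSq_mul, Complex.normSq_inv, ← div_eq_mul_inv,
      lt_div_iff₀ (Complex.normSq_pos.2 h0)]
    exact mem_cone_nearP.1 hq

theorem fderiv_polePrim_apply (a : ℂ) {f : ℂ → ℂ} (hf : Differentiable ℂ f) {p : HomCoord}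
    (h0 : p.1 0 ≠ 0) (hp : p ∈ cone nearP) (w h : HomCoord) :
    fderiv ℝ (fun q => polePrim a f q w) p h =
      deriv (resPrim a f) p.2 * h.2 * ((p.1 1)⁻¹ * w.1 1 - (p.1 0)⁻¹ * w.1 0) +
      resPrim a f p.2 * (-h.1 1 * w.1 1 * (p.1 1 ^ 2)⁻¹ + h.1 0 * w.1 0 * (p.1 0 ^ 2)⁻¹) +
      deriv f p.2 * h.2 * (a - 1 - p.1 1 * (p.1 0)⁻¹) * w.2 -
      f p.2 * (h.1 1 * (p.1 0)⁻¹ - p.1 1 * h.1 0 * (p.1 0 ^ 2)⁻¹) * w.2 := by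
  have e : (fun q => polePrim a f q w) =ᶠ[𝓝 p] fun q =>
      resPrim a f q.2 * ((q.1 1)⁻¹ * w.1 1 - (q.1 0)⁻¹ * w.1 0) +
        f q.2 * (a - 1 - q.1 1 * (q.1 0)⁻¹) * w.2 := by
    filter_upwards [(isOpen_setOf_xi_ne_zero 0).mem_nhds h0, isOpen_cone_nearP.mem_nhds hp]
      with q hq0 hq
    exact polePrim_apply_of_mem_nearP a f hq0 hq w
  have h1 := xi_one_ne_zero_of_mem_cone_nearP hp
  have hd := ((hasFDerivAt_comp_snd (differentiable_resPrim a hf) p).mul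
    (((hasFDerivAt_inv_xi h1).mul_const (w.1 1)).sub
      ((hasFDerivAt_inv_xi h0).mul_const (w.1 0)))).add
    (((hasFDerivAt_comp_snd hf p).mul (((hasFDerivAt_xi 1 p).mul
      (hasFDerivAt_inv_xi h0)).const_sub (a - 1))).mul_const w.2)
  rw [e.fderiv_eq]
  erw [(hd.restrictScalars ℝ).fderiv]
  simp
  ring

theorem deriv_resPrim (a : ℂ) {f : ℂ → ℂ} (hf : Differentiable ℂ f) (w : ℂ) :
    deriv (resPrim a f) w = deriv f w * ((a - 1) * w + 1) + f w * (a - 1) := by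
  have h1 : HasDerivAt (fun w : ℂ => (a - 1) * w + 1) (a - 1) w := by
    simpa using ((hasDerivAt_id w).const_mul (a - 1)).add_const 1
  exact ((hf w).hasDerivAt.mul h1).deriv

theorem hasFDerivAt_etaP {p : HomCoord} (h1 : p.1 1 ≠ 0) :
    HasFDerivAt (𝕜 := ℝ) (etaP 0) (-(p.1 1 ^ 2)⁻¹ • omegaStar p) p := by
  have hd := (hasFDerivAt_xi 0 p).mul (hasFDerivAt_inv_xi h1)
  have e : etaP 0 = fun q : HomCoord => q.1 0 * (q.1 1)⁻¹ := by
    ext q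
    simp [etaP, div_eq_mul_inv]
  rw [e]
  refine (hd.restrictScalars ℝ).congr_fderiv ?_
  refine ContinuousLinearMap.ext fun v => ?_
  simp [omegaStar_apply]
  field_simp
  ring

/-- The coefficient form `g'(x) dx` of the polar part. -/
noncomputable def residueForm (a : ℂ) (f : ℂ → ℂ) (p : HomCoord) : HomCoord →L[ℝ] ℂ :=
  deriv (resPrim a f) p.2 • dx

/-- The differential of `polePrim` is dη/η ∧ g' dx + f dη ∧ dx / η²; its second term cancels f Ψ₀,
so no smooth remainder θ is left. -/
theorem formPsi_add_extDeriv_polePrim (a : ℂ) {f : ℂ → ℂ} (hf : Differentiable ℂ f) {p : HomCoord}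
    (h0 : p.1 0 ≠ 0) (hp : p ∈ cone nearP) :
    formPsi 0 f p + extDeriv (fun q => oneForm (polePrim a f q)) p =
      (etaP 0 p)⁻¹ • wedge (fderiv ℝ (etaP 0) p) (residueForm a f p) := by
  have h1 := xi_one_ne_zero_of_mem_cone_nearP hp
  ext v
  rw [ContinuousAlternatingMap.add_apply, extDeriv_one_apply (differentiableAt_of_isForm
    (isForm_polePrim a hf) isOpen_cone_diff_hypP (mem_cone_diff_hypP.2 h0)), formPsi_apply]
  simp only [oneForm_apply, Matrix.cons_val_zero]
  rw [fderiv_polePrim_apply a hf h0 hp, fderiv_polePrim_apply a hf h0 hp,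
    (hasFDerivAt_etaP h1).fderiv]
  simp [wedge_apply, residueForm, etaP, omegaStar_apply, deriv_resPrim a hf, resPrim]
  field_simp
  ring

theorem hasFDerivAt_toP (x : ℂ) : HasFDerivAt (𝕜 := ℝ) (toP 0)
    ((0 : ℂ →L[ℝ] (Fin 2 → ℂ)).prod (ContinuousLinearMap.id ℝ ℂ)) x :=
  (hasFDerivAt_const _ x).prodMk (hasFDerivAt_id x)

theorem pullback_toP_apply (τ : HomCoord → HomCoord [⋀^Fin 1]→L[ℝ] ℂ) (x : ℂ) (v : Fin 1 → ℂ) :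
    pullback (toP 0) τ x v = τ (toP 0 x) ![(0, v 0)] := by
  rw [pullback, (hasFDerivAt_toP x).fderiv]
  change τ (toP 0 x) _ = _
  congr 1
  ext i
  all_goals
    obtain rfl := Subsingleton.elim i 0
    simp

theorem isRelResidue_formPsi (a : ℂ) {f : ℂ → ℂ} (hf : Differentiable ℂ f) :
    IsRelResidue univ 0 (hypS a) (formPsi 0 f)
      (fun x => oneForm ((ContinuousLinearMap.toSpanSingleton ℂ
        (deriv (fun w => f w * ((a - 1) * w + 1)) x)).restrictScalars ℝ)) := by
  have hg : Differentiable ℂ (deriv (resPrim a f)) :=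
    ((differentiable_resPrim a hf).contDiff (n := 2)).differentiable_deriv_two
  change IsRelResidue univ 0 (hypS a) (formPsi 0 f)
      (fun x => oneForm ((ContinuousLinearMap.toSpanSingleton ℂ
        (deriv (resPrim a f) x)).restrictScalars ℝ))
  refine ⟨isRelCocycle_formPsi a hf, fun x _ => ?_, fun p => oneForm (polePrim a f p),
    isForm_polePrim a hf, vanishesOn_hypQ_polePrim a f, vanishesOn_hypS_polePrim a f, nearP,
    isOpen_cone_nearP, hypP_subset_nearP, fun _ _ => mem_univ _,
    fun p => xi_one_ne_zero_of_mem_cone_nearP, residueForm a f, fun _ => 0, ?_, ?_, ?_, ?_⟩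
  · have hd : Differentiable ℝ (fun x : ℂ => oneForm ((ContinuousLinearMap.toSpanSingleton ℂ
        (deriv (resPrim a f) x)).restrictScalars ℝ)) := by
      have e : (fun x : ℂ => oneForm ((ContinuousLinearMap.toSpanSingleton ℂ
          (deriv (resPrim a f) x)).restrictScalars ℝ)) =
          fun x => oneForm (deriv (resPrim a f) x • ContinuousLinearMap.id ℝ ℂ) := by
        ext x v
        simp [mul_comm]
      rw [e]
      exact (contDiff_oneForm.comp ((contDiff_entire hg).smul contDiff_const)).differentiable
        (by simp)
    have h1 : ∀ w : ℂ, HasFDerivAt (fun y : ℂ => w * deriv (resPrim a f) y)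
        (ContinuousLinearMap.toSpanSingleton ℂ (w * deriv (deriv (resPrim a f)) x)) x := fun w =>
      ((hg x).hasDerivAt.const_mul w).hasFDerivAt
    ext v
    rw [extDeriv_one_apply (hd x)]
    simp only [oneForm_apply, Matrix.cons_val_zero, ContinuousLinearMap.coe_restrictScalars',
      ContinuousLinearMap.toSpanSingleton_apply, smul_eq_mul]
    rw [((h1 _).restrictScalars ℝ).fderiv, ((h1 _).restrictScalars ℝ).fderiv]
    change _ = (0 : ℂ)
    simp
    ring
  · refine ⟨contDiff_oneForm.comp_contDiffOn ((((contDiff_entire hg).comp contDiff_dx).smul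
      contDiff_const).contDiffOn), fun p hp c hc v => rfl, ?_⟩
    rintro p hp v ⟨i, c, hi⟩
    obtain rfl := Subsingleton.elim i 0
    simp [residueForm, hi]
  · exact ⟨contDiffOn_const, fun _ _ _ _ _ => rfl, fun _ _ _ _ => rfl⟩
  · rintro p ⟨h, hp⟩
    have h0 : p.1 0 ≠ 0 := mem_cone_diff_hypP.1 ⟨h, mem_univ _, hp.2⟩
    rw [formPsi_add_extDeriv_polePrim a hf h0 ⟨h, hp.1⟩, add_zero]
  · intro x _
    ext v
    rw [pullback_toP_apply]
    simp [residueForm, toP, mul_comm]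

/-! ### Tubes around the segment in P, and Stokes' theorem. -/

/-- A 1-form as a field of real-linear functionals. -/
noncomputable def covector {V : Type} [NormedAddCommGroup V] [NormedSpace ℝ V]
    (τ : V [⋀^Fin 1]→L[ℝ] ℂ) : V →L[ℝ] ℂ :=
  (ContinuousAlternatingMap.ofSubsingletonLIE (𝕜 := ℝ) (E := V) (F := ℂ) (0 : Fin 1)).symm τ

theorem covector_apply {V : Type} [NormedAddCommGroup V] [NormedSpace ℝ V]
    (τ : V [⋀^Fin 1]→L[ℝ] ℂ) (v : V) : covector τ v = τ ![v] := by
  have h : oneForm (covector τ) = τ :=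
    (ContinuousAlternatingMap.ofSubsingletonLIE (𝕜 := ℝ) (E := V) (F := ℂ)
      (0 : Fin 1)).apply_symm_apply τ
  rw [← h]
  rfl

theorem contDiff_covector {V : Type} [NormedAddCommGroup V] [NormedSpace ℝ V] :
    ContDiff ℝ ∞ (covector : V [⋀^Fin 1]→L[ℝ] ℂ → V →L[ℝ] ℂ) :=
  (ContinuousAlternatingMap.ofSubsingletonLIE (𝕜 := ℝ) (E := V) (F := ℂ) (0 : Fin 1)).symm.contDiff

/-- The point `η = ε e^{iθ}` of the circle of radius `ε`. -/
noncomputable def tubeEta (ε θ : ℝ) : ℂ := ε * Complex.exp (Complex.I * θ)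

/-- The tube of radius `ε` around the segment from `P ∩ S` to `P ∩ Q`, with boundary circles in `S`
and in `Q`. -/
noncomputable def tube (a : ℂ) (ε : ℝ) (y : ℝ × ℝ) : HomCoord :=
  (![tubeEta ε y.1, 1], (1 - y.2) - tubeEta ε y.1 * ((1 - y.2) * a + y.2))

/-- The derivative of the tube along its circles. -/
noncomputable def tubeDTheta (a : ℂ) (ε : ℝ) (y : ℝ × ℝ) : HomCoord :=
  (![Complex.I * tubeEta ε y.1, 0], -(Complex.I * tubeEta ε y.1 * ((1 - y.2) * a + y.2)))

/-- The derivative of the tube along its length. -/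
noncomputable def tubeDT (a : ℂ) (ε : ℝ) (y : ℝ × ℝ) : HomCoord :=
  (0, -1 - tubeEta ε y.1 * (1 - a))

theorem hasFDerivAt_tubeEta (ε : ℝ) (y : ℝ × ℝ) :
    HasFDerivAt (fun y : ℝ × ℝ => tubeEta ε y.1)
      ((Complex.I * tubeEta ε y.1) • Complex.ofRealCLM.comp (ContinuousLinearMap.fst ℝ ℝ ℝ)) y := by
  have h : HasFDerivAt (fun y : ℝ × ℝ => (y.1 : ℂ))
      (Complex.ofRealCLM.comp (ContinuousLinearMap.fst ℝ ℝ ℝ)) y :=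
    (Complex.ofRealCLM.comp (ContinuousLinearMap.fst ℝ ℝ ℝ)).hasFDerivAt
  refine ((h.const_mul Complex.I).cexp.const_mul (ε : ℂ)).congr_fderiv ?_
  refine ContinuousLinearMap.ext fun v => ?_
  simp [tubeEta]
  ring

theorem hasFDerivAt_tube (a : ℂ) (ε : ℝ) (y : ℝ × ℝ) :
    ∃ L : ℝ × ℝ →L[ℝ] HomCoord, HasFDerivAt (tube a ε) L y ∧
      L (1, 0) = tubeDTheta a ε y ∧ L (0, 1) = tubeDT a ε y := by
  have h2 : HasFDerivAt (fun y : ℝ × ℝ => (y.2 : ℂ))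
      (Complex.ofRealCLM.comp (ContinuousLinearMap.snd ℝ ℝ ℝ)) y :=
    (Complex.ofRealCLM.comp (ContinuousLinearMap.snd ℝ ℝ ℝ)).hasFDerivAt
  have hE := hasFDerivAt_tubeEta ε y
  have hxi : HasFDerivAt (fun y : ℝ × ℝ => (![tubeEta ε y.1, 1] : Fin 2 → ℂ))
      (ContinuousLinearMap.pi ![(Complex.I * tubeEta ε y.1) •
        Complex.ofRealCLM.comp (ContinuousLinearMap.fst ℝ ℝ ℝ), 0]) y := by
    refine hasFDerivAt_pi.2 fun i => ?_
    fin_cases i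
    · exact hE
    · exact hasFDerivAt_const (1 : ℂ) y
  have hx := (h2.const_sub 1).sub (hE.mul (((h2.const_sub 1).mul_const a).add h2))
  refine ⟨_, hxi.prodMk hx, ?_, ?_⟩
  · refine Prod.ext (funext fun i => ?_) ?_
    · fin_cases i <;> simp [tubeDTheta]
    · simp [tubeDTheta]
      ring
  · refine Prod.ext (funext fun i => ?_) ?_
    · fin_cases i <;> simp [tubeDT]
    · simp [tubeDT]
      ring

theorem contDiff_tubeEta (ε : ℝ) : ContDiff ℝ ∞ (fun y : ℝ × ℝ => tubeEta ε y.1) :=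
  contDiff_const.mul (contDiff_const.mul (contDiff_ofReal.comp contDiff_fst)).cexp

theorem contDiff_tube (a : ℂ) (ε : ℝ) : ContDiff ℝ ∞ (tube a ε) := by
  have h2 : ContDiff ℝ ∞ (fun y : ℝ × ℝ => (y.2 : ℂ)) := contDiff_ofReal.comp contDiff_snd
  have hE := contDiff_tubeEta ε
  refine ContDiff.prodMk (contDiff_pi.2 fun i => ?_)
    ((contDiff_const.sub h2).sub (hE.mul (((contDiff_const.sub h2).mul contDiff_const).add h2)))
  fin_cases i
  · exact hE
  · exact contDiff_const

theorem fderiv_tube_one_zero (a : ℂ) (ε : ℝ) (y : ℝ × ℝ) :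
    fderiv ℝ (tube a ε) y (1, 0) = tubeDTheta a ε y := by
  obtain ⟨L, hL, h1, h2⟩ := hasFDerivAt_tube a ε y
  rw [hL.fderiv, h1]

theorem fderiv_tube_zero_one (a : ℂ) (ε : ℝ) (y : ℝ × ℝ) :
    fderiv ℝ (tube a ε) y (0, 1) = tubeDT a ε y := by
  obtain ⟨L, hL, h1, h2⟩ := hasFDerivAt_tube a ε y
  rw [hL.fderiv, h2]

theorem tubeEta_ne_zero {ε : ℝ} (hε : ε ≠ 0) (θ : ℝ) : tubeEta ε θ ≠ 0 :=
  mul_ne_zero (Complex.ofReal_ne_zero.2 hε) (Complex.exp_ne_zero _)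

theorem tubeEta_two_pi (ε : ℝ) : tubeEta ε (2 * Real.pi) = tubeEta ε 0 := by
  have : Complex.I * ((2 * Real.pi : ℝ) : ℂ) = 2 * Real.pi * Complex.I := by
    push_cast
    ring
  rw [tubeEta, tubeEta, this, Complex.exp_two_pi_mul_I]
  simp

theorem tube_mem_cone_diff_hypP (a : ℂ) {ε : ℝ} (hε : ε ≠ 0) (y : ℝ × ℝ) :
    tube a ε y ∈ cone (spaceY univ \ hypP univ 0) :=
  mem_cone_diff_hypP.2 (tubeEta_ne_zero hε y.1)

theorem tube_ne_zero (a : ℂ) (ε : ℝ) (y : ℝ × ℝ) : (tube a ε y).1 ≠ 0 :=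
  hom_ne_zero_iff.2 (Or.inr one_ne_zero)

theorem tube_mem_hypQ (a : ℂ) (ε θ : ℝ) : tube a ε (θ, 1) ∈ cone (hypQ univ) :=
  mem_cone_hypQ.2 ⟨tube_ne_zero _ _ _, by simp [tube]⟩

theorem tube_mem_hypS (a : ℂ) (ε θ : ℝ) : tube a ε (θ, 0) ∈ cone (hypS a) := by
  refine mem_cone_hypS.2 ⟨tube_ne_zero _ _ _, ?_⟩
  by_cases ha : a = 0
  · simp [tube, defS, ha]
  · simp [tube, defS, ha]
    ring

theorem mem_tangentConeAt_of_hasDerivAt {A : Set HomCoord} {c : ℝ → HomCoord} {c' : HomCoord}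
    {t : ℝ}
    (hc : HasDerivAt c c' t) (hA : ∀ s, c s ∈ A) : c' ∈ tangentConeAt ℝ A (c t) := by
  have h1 : (1 : ℝ) ∈ tangentConeAt ℝ univ t := by
    rw [tangentConeAt_univ]
    exact mem_univ _
  have h := (hc.hasFDerivAt.hasFDerivWithinAt (s := univ)).mapsTo_tangent_cone h1
  have h2 := tangentConeAt_mono (𝕜 := ℝ) (x := c t)
    (image_subset_iff.2 fun s _ => hA s : c '' univ ⊆ A) h
  simpa using h2

theorem hasDerivAt_tube_left (a : ℂ) (ε θ t : ℝ) :
    HasDerivAt (fun s => tube a ε (s, t)) (tubeDTheta a ε (θ, t)) θ := by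
  obtain ⟨L, hL, h1, -⟩ := hasFDerivAt_tube a ε (θ, t)
  have := hL.comp_hasDerivAt θ ((hasDerivAt_id θ).prodMk (hasDerivAt_const θ t))
  rw [h1] at this
  exact this

/-- Stokes on the parameter rectangle: the sides θ = 0 and θ = 2π cancel by periodicity, and on t =
0 and t = 1 the tube runs in S and in Q, where σ vanishes. -/
theorem integral_extDeriv_tube_eq_zero (a : ℂ) {σ : HomCoord → HomCoord [⋀^Fin 1]→L[ℝ] ℂ}
    (hσ : IsForm (spaceY univ \ hypP univ 0) σ)
    (hQ : VanishesOn (spaceY univ \ hypP univ 0) (hypQ univ) σ)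
    (hS : VanishesOn (spaceY univ \ hypP univ 0) (hypS a) σ) {ε : ℝ} (hε : ε ≠ 0) :
    ∫ θ in (0 : ℝ)..(2 * Real.pi), ∫ t in (0 : ℝ)..1,
      extDeriv σ (tube a ε (θ, t)) ![tubeDTheta a ε (θ, t), tubeDT a ε (θ, t)] = 0 := by
  have hU := contDiff_tube a ε
  have hmem := tube_mem_cone_diff_hypP a hε
  have hσU : ContDiff ℝ ∞ (fun y => covector (σ (tube a ε y))) := by
    refine contDiff_covector.comp (contDiff_iff_contDiffAt.2 fun y => ?_)
    exact (hσ.1.contDiffAt (isOpen_cone_diff_hypP.mem_nhds (hmem y))).comp y hU.contDiffAt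
  have hU' : ContDiff ℝ ∞ (fderiv ℝ (tube a ε)) := hU.fderiv_right (by simp)
  set F : ℝ × ℝ → (ℝ × ℝ) → ℂ := fun v y => covector (σ (tube a ε y)) (fderiv ℝ (tube a ε) y v)
    with hF
  have hFs : ∀ v, ContDiff ℝ ∞ (F v) := fun v => hσU.clm_apply (hU'.clm_apply contDiff_const)
  have hFd : ∀ v y, HasFDerivAt (F v) (fderiv ℝ (F v) y) y := fun v y =>
    ((hFs v).differentiable (by simp) y).hasFDerivAt
  have hFc : ∀ v w, Continuous fun y => fderiv ℝ (F v) y w := fun v w =>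
    ((hFs v).continuous_fderiv (by simp)).clm_apply continuous_const
  have two_le : minSmoothness ℝ 2 ≤ (∞ : WithTop ℕ∞) := by
    rw [minSmoothness_of_isRCLikeNormedField]
    exact WithTop.coe_le_coe.2 (le_top : (2 : ℕ∞) ≤ ⊤)
  have key : ∀ y, extDeriv σ (tube a ε y) ![tubeDTheta a ε y, tubeDT a ε y] =
      fderiv ℝ (F (0, 1)) y (1, 0) + (-fderiv ℝ (F (1, 0)) y) (0, 1) := by
    intro y
    have hd := differentiableAt_of_isForm hσ isOpen_cone_diff_hypP (hmem y)
    have h1 := congrArg (fun τ : (ℝ × ℝ) [⋀^Fin 2]→L[ℝ] ℂ => τ ![(1, 0), (0, 1)])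
      (extDeriv_pullback hd (hU.contDiffAt (x := y)) two_le)
    have hd' : DifferentiableAt ℝ (fun y => (σ (tube a ε y)).compContinuousLinearMap
        (fderiv ℝ (tube a ε) y)) y :=
      DifferentiableAt.continuousAlternatingMapCompContinuousLinearMap
        (hd.comp y (hU.differentiable (by simp) y)) (hU'.differentiable (by simp) y)
    have e1 : ∀ v : ℝ × ℝ, (fun y => (σ (tube a ε y)).compContinuousLinearMap
        (fderiv ℝ (tube a ε) y) ![v]) = F v := by
      intro v
      ext y
      rw [hF]
      simp only [covector_apply]
      rw [ContinuousAlternatingMap.compContinuousLinearMap_apply]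
      congr 1
      ext i
      all_goals
        obtain rfl := Subsingleton.elim i 0
        rfl
    simp only [extDeriv_one_apply hd', Matrix.cons_val_zero, Matrix.cons_val_one, e1] at h1
    rw [neg_apply, ← sub_eq_add_neg, h1,
      ContinuousAlternatingMap.compContinuousLinearMap_apply, ← fderiv_tube_one_zero,
      ← fderiv_tube_zero_one]
    congr 1
    ext i
    all_goals
      fin_cases i <;> rfl
  -- `F v` is the pullback of σ to the rectangle evaluated on `v`. The differential of the pullback
  -- is the divergence of the field (`F (0, 1)`, `-F (1, 0)`).
  have hdiv := MeasureTheory.integral2_divergence_prod_of_hasFDerivAt (F (0, 1))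
    (fun y => -F (1, 0) y)
    (fderiv ℝ (F (0, 1))) (fun y => -fderiv ℝ (F (1, 0)) y) 0 0 (2 * Real.pi) 1
    (hFs _).continuous.continuousOn (hFs _).continuous.neg.continuousOn (fun y _ => hFd _ y)
    (fun y _ => (hFd _ y).neg)
    (((hFc _ _).add ((hFc _ _).neg)).continuousOn.integrableOn_compact
      (isCompact_uIcc.prod isCompact_uIcc))
  simp only [key]
  rw [hdiv]
  have hF1 : ∀ θ : ℝ, F (1, 0) (θ, 1) = 0 := by
    intro θ
    rw [hF]
    simp only [covector_apply, fderiv_tube_one_zero]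
    refine hQ _ (hmem _) (tube_mem_hypQ a ε θ) _ fun i => ?_
    obtain rfl := Subsingleton.elim i 0
    exact mem_tangentConeAt_of_hasDerivAt (hasDerivAt_tube_left a ε θ 1) (tube_mem_hypQ a ε)
  have hF0 : ∀ θ : ℝ, F (1, 0) (θ, 0) = 0 := by
    intro θ
    rw [hF]
    simp only [covector_apply, fderiv_tube_one_zero]
    refine hS _ (hmem _) (tube_mem_hypS a ε θ) _ fun i => ?_
    obtain rfl := Subsingleton.elim i 0
    exact mem_tangentConeAt_of_hasDerivAt (hasDerivAt_tube_left a ε θ 0) (tube_mem_hypS a ε)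
  have hper : ∀ t : ℝ, F (0, 1) (2 * Real.pi, t) = F (0, 1) (0, t) := by
    intro t
    rw [hF]
    simp only [covector_apply, fderiv_tube_zero_one]
    simp only [tube, tubeDT, tubeEta_two_pi]
  simp [hF1, hF0, hper]

/-- On the tube dη/η = i dθ, with no dt component. The polar part therefore has no singularity as
the radius tends to 0. -/
theorem wedge_etaP_tube (a : ℂ) {ε : ℝ} (hε : ε ≠ 0) (y : ℝ × ℝ) (α : HomCoord →L[ℝ] ℂ) :
    ((etaP 0 (tube a ε y))⁻¹ • wedge (fderiv ℝ (etaP 0) (tube a ε y)) α)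
      ![tubeDTheta a ε y, tubeDT a ε y] = Complex.I * α (tubeDT a ε y) := by
  have h := tubeEta_ne_zero hε y.1
  have h1 : (tube a ε y).1 1 ≠ 0 := one_ne_zero
  rw [(hasFDerivAt_etaP h1).fderiv]
  simp [wedge_apply, omegaStar_apply, etaP]
  simp [tube, tubeDTheta, tubeDT]
  field_simp

theorem continuous_tube (a : ℂ) : Continuous fun q : ℝ × ℝ × ℝ => tube a q.1 q.2 := by
  unfold tube tubeEta
  fun_prop

theorem continuous_tubeDTheta (a : ℂ) : Continuous fun q : ℝ × ℝ × ℝ => tubeDTheta a q.1 q.2 := by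
  unfold tubeDTheta tubeEta
  fun_prop

theorem continuous_tubeDT (a : ℂ) : Continuous fun q : ℝ × ℝ × ℝ => tubeDT a q.1 q.2 := by
  unfold tubeDT tubeEta
  fun_prop

theorem tube_zero (a : ℂ) (θ t : ℝ) : tube a 0 (θ, t) = toP 0 (1 - t) := by
  simp [tube, tubeEta, toP]

theorem tubeDT_zero (a : ℂ) (θ t : ℝ) : tubeDT a 0 (θ, t) = (0, -1) := by
  simp [tubeDT, tubeEta]

theorem tubeDTheta_zero (a : ℂ) (θ t : ℝ) : tubeDTheta a 0 (θ, t) = 0 := by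
  simp [tubeDTheta, tubeEta]

theorem toP_mem_cone {W : Set ProjTimes} (hW : hypP univ 0 ⊆ W) (x : ℂ) : toP 0 x ∈ cone W :=
  cone_mono hW (mem_cone_hypP.2 ⟨hom_ne_zero_iff.2 (Or.inr one_ne_zero), by simp [toP]⟩)

theorem exists_tube_mem_cone (a : ℂ) {W : Set ProjTimes} (hW : IsOpen (cone W))
    (hP : hypP univ 0 ⊆ W) : ∃ δ > 0, ∀ ε ∈ Icc (0 : ℝ) δ, ∀ θ ∈ Icc (0 : ℝ) (2 * Real.pi),
      ∀ t ∈ Icc (0 : ℝ) 1, tube a ε (θ, t) ∈ cone W := by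
  have hopen : IsOpen {q : ℝ × ℝ × ℝ | tube a q.1 q.2 ∈ cone W} :=
    hW.preimage (continuous_tube a)
  obtain ⟨u, v, hu, hv, hsu, htv, huv⟩ := generalized_tube_lemma
    (isCompact_singleton (x := (0 : ℝ)))
    ((isCompact_Icc (a := (0 : ℝ)) (b := 2 * Real.pi)).prod (isCompact_Icc (a := (0 : ℝ)) (b := 1)))
    hopen (by
      rintro ⟨ε, θ, t⟩ ⟨hε, -⟩
      obtain rfl : ε = 0 := hε
      change tube a 0 (θ, t) ∈ cone W
      rw [tube_zero]
      exact toP_mem_cone hP _)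
  obtain ⟨δ, hδ, hball⟩ := Metric.isOpen_iff.1 hu 0 (hsu rfl)
  refine ⟨δ / 2, by positivity, fun ε hε θ hθ t ht => ?_⟩
  refine @huv (ε, θ, t) ⟨hball ?_, htv ⟨hθ, ht⟩⟩
  rw [Metric.mem_ball, Real.dist_eq, sub_zero, abs_of_nonneg hε.1]
  linarith [hε.2]

/-- The integral of dσ over the tube of radius ε > 0 is 0. Its integrand extends continuously to ε =
0, where the tube collapses to the segment in P and the integral becomes 2πi times the one in the
conclusion. -/
theorem integral_polar_part_eq_zero (a : ℂ) {σ : HomCoord → HomCoord [⋀^Fin 1]→L[ℝ] ℂ}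
    (hσ : IsForm (spaceY univ \ hypP univ 0) σ)
    (hQ : VanishesOn (spaceY univ \ hypP univ 0) (hypQ univ) σ)
    (hS : VanishesOn (spaceY univ \ hypP univ 0) (hypS a) σ)
    {W : Set ProjTimes} (hW : IsOpen (cone W)) (hP : hypP univ 0 ⊆ W)
    {ψ : HomCoord → HomCoord →L[ℝ] ℂ} {θ : HomCoord → HomCoord [⋀^Fin 2]→L[ℝ] ℂ}
    (hψ : ContinuousOn ψ (cone W)) (hθ : ContinuousOn θ (cone W))
    (heq : ∀ p ∈ cone (W \ hypP univ 0), extDeriv σ p =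
      (etaP 0 p)⁻¹ • wedge (fderiv ℝ (etaP 0) p) (ψ p) + θ p) :
    ∫ t in (0 : ℝ)..1, ψ (toP 0 (1 - t)) (0, -1) = 0 := by
  obtain ⟨δ, hδ, hmem⟩ := exists_tube_mem_cone a hW hP
  set H : ℝ × ℝ × ℝ → ℂ := fun q => Complex.I * ψ (tube a q.1 q.2) (tubeDT a q.1 q.2) +
    θ (tube a q.1 q.2) ![tubeDTheta a q.1 q.2, tubeDT a q.1 q.2] with hH
  set D : Set (ℝ × ℝ × ℝ) := Icc 0 δ ×ˢ Icc 0 (2 * Real.pi) ×ˢ Icc 0 1 with hD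
  have hmaps : MapsTo (fun q : ℝ × ℝ × ℝ => tube a q.1 q.2) D (cone W) := by
    rintro ⟨ε, s, t⟩ ⟨h1, h2, h3⟩
    exact hmem ε h1 s h2 t h3
  have hHc : ContinuousOn H D := by
    have hc := (continuous_tube a).continuousOn (s := D)
    have hc1 := (continuous_tubeDTheta a).continuousOn (s := D)
    have hc2 := (continuous_tubeDT a).continuousOn (s := D)
    refine ContinuousOn.add (continuousOn_const.mul ((hψ.comp hc hmaps).clm_apply hc2))
      ((hθ.comp hc hmaps).eval (continuousOn_pi.2 fun i => ?_))
    fin_cases i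
    · exact hc1
    · exact hc2
  have hpi : (0 : ℝ) ≤ 2 * Real.pi := by positivity
  -- Clamping to the box turns `H`, continuous only on `D`, into a function continuous everywhere,
  -- as needed for continuity of the integral in ε.
  set c : ℝ × ℝ × ℝ → ℝ × ℝ × ℝ := fun q => (projIcc 0 δ hδ.le q.1,
    projIcc 0 (2 * Real.pi) hpi q.2.1, projIcc 0 1 zero_le_one q.2.2) with hc
  have hcc : Continuous c := by
    refine (continuous_subtype_val.comp (continuous_projIcc.comp continuous_fst)).prodMk
      ((continuous_subtype_val.comp
        (continuous_projIcc.comp (continuous_fst.comp continuous_snd))).prodMk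
        (continuous_subtype_val.comp
          (continuous_projIcc.comp (continuous_snd.comp continuous_snd))))
  have hcD : ∀ q, c q ∈ D := fun q => ⟨(projIcc 0 δ hδ.le _).2,
    (projIcc 0 (2 * Real.pi) hpi _).2, (projIcc (0 : ℝ) 1 zero_le_one _).2⟩
  have hcid : ∀ q ∈ D, c q = q := by
    rintro ⟨ε, s, t⟩ ⟨h1, h2, h3⟩
    simp only [hc, projIcc_of_mem _ h1, projIcc_of_mem _ h2, projIcc_of_mem _ h3]
  have hK : Continuous fun q => H (c q) := hHc.comp_continuous hcc hcD
  have hJ : Continuous fun ε : ℝ =>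
      ∫ s in (0 : ℝ)..(2 * Real.pi), ∫ t in (0 : ℝ)..1, H (c (ε, s, t)) := by
    refine intervalIntegral.continuous_parametric_intervalIntegral_of_continuous' ?_ _ _
    refine intervalIntegral.continuous_parametric_intervalIntegral_of_continuous'
      (f := fun (q : ℝ × ℝ) t => H (c (q.1, q.2, t))) ?_ _ _
    exact hK.comp (by fun_prop : Continuous fun q : (ℝ × ℝ) × ℝ => (q.1.1, q.1.2, q.2))
  have hcongr : ∀ ε ∈ Icc (0 : ℝ) δ, ∀ H' : ℝ → ℝ → ℂ,
      (∀ s ∈ Icc (0 : ℝ) (2 * Real.pi), ∀ t ∈ Icc (0 : ℝ) 1, H (ε, s, t) = H' s t) →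
      ∫ s in (0 : ℝ)..(2 * Real.pi), ∫ t in (0 : ℝ)..1, H (c (ε, s, t)) =
        ∫ s in (0 : ℝ)..(2 * Real.pi), ∫ t in (0 : ℝ)..1, H' s t := by
    intro ε hε H' hH'
    refine intervalIntegral.integral_congr fun s hs =>
      intervalIntegral.integral_congr fun t ht => ?_
    rw [uIcc_of_le hpi] at hs
    rw [uIcc_of_le zero_le_one] at ht
    rw [hcid _ ⟨hε, hs, ht⟩, hH' s hs t ht]
  have hpos : ∀ ε ∈ Ioc (0 : ℝ) δ,
      ∫ s in (0 : ℝ)..(2 * Real.pi), ∫ t in (0 : ℝ)..1, H (c (ε, s, t)) = 0 := by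
    intro ε hε
    rw [← integral_extDeriv_tube_eq_zero a hσ hQ hS hε.1.ne']
    refine hcongr ε (Ioc_subset_Icc_self hε) _ fun s hs t ht => ?_
    have h1 := hmem ε (Ioc_subset_Icc_self hε) s hs t ht
    have h2 := tube_mem_cone_diff_hypP a hε.1.ne' (s, t)
    rw [heq _ ⟨h1.1, h1.2, h2.2.2⟩, ContinuousAlternatingMap.add_apply, wedge_etaP_tube a hε.1.ne']
  have hzero : ∫ s in (0 : ℝ)..(2 * Real.pi), ∫ t in (0 : ℝ)..1, H (c (0, s, t)) = 0 := by
    refine tendsto_nhds_unique ((hJ.tendsto 0).mono_left nhdsWithin_le_nhds :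
      Tendsto _ (𝓝[>] (0 : ℝ)) _) (tendsto_const_nhds.congr' ?_)
    filter_upwards [Ioc_mem_nhdsGT hδ] with ε hε
    exact (hpos ε hε).symm
  rw [hcongr 0 ⟨le_rfl, hδ.le⟩ (fun _ t => Complex.I * ψ (toP 0 (1 - t)) (0, -1))] at hzero
  · simp only [intervalIntegral.integral_const_mul, intervalIntegral.integral_const] at hzero
    simpa [Real.pi_ne_zero] using hzero
  · intro s _ t _
    simp only [hH, tube_zero, tubeDT_zero, tubeDTheta_zero]
    -- At radius 0 the derivative along the circles is zero, which kills the smooth remainder.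
    rw [(θ _).map_coord_zero (0 : Fin 2) rfl, add_zero]

/-! ### Independence of the form representing the residue. -/

theorem IsForm.sub {k : ℕ} {W : Set ProjTimes} {τ τ' : HomCoord → HomCoord [⋀^Fin k]→L[ℝ] ℂ}
    (h : IsForm W τ) (h' : IsForm W τ') : IsForm W (fun p => τ p - τ' p) := by
  refine ⟨h.1.sub h'.1, fun p hp c hc v => ?_, fun p hp v hv => ?_⟩
  · rw [ContinuousAlternatingMap.sub_apply, ContinuousAlternatingMap.sub_apply,
      h.2.1 p hp c hc v, h'.2.1 p hp c hc v]
  · rw [ContinuousAlternatingMap.sub_apply, h.2.2 p hp v hv, h'.2.2 p hp v hv, sub_zero]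

theorem VanishesOn.sub {k : ℕ} {W A : Set ProjTimes} {τ τ' : HomCoord → HomCoord [⋀^Fin k]→L[ℝ] ℂ}
    (h : VanishesOn W A τ) (h' : VanishesOn W A τ') : VanishesOn W A (fun p => τ p - τ' p) := by
  intro p hp hA v hv
  rw [ContinuousAlternatingMap.sub_apply, h p hp hA v hv, h' p hp hA v hv, sub_zero]

theorem extDeriv_fun_sub {k : ℕ} {τ τ' : HomCoord → HomCoord [⋀^Fin k]→L[ℝ] ℂ} {p : HomCoord}
    (h : DifferentiableAt ℝ τ p) (h' : DifferentiableAt ℝ τ' p) :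
    extDeriv (fun p => τ p - τ' p) p = extDeriv τ p - extDeriv τ' p := by
  have h1 := extDeriv_add (h.sub h') h'
  rw [sub_add_cancel] at h1
  exact eq_sub_of_add_eq h1.symm

theorem cone_inter (A B : Set ProjTimes) : cone (A ∩ B) = cone A ∩ cone B :=
  Subset.antisymm (fun _ ⟨h, hA, hB⟩ => ⟨⟨h, hA⟩, h, hB⟩) fun _ ⟨⟨h, hA⟩, _, hB⟩ => ⟨h, hA, hB⟩

theorem wedge_sub (α β β' : HomCoord →L[ℝ] ℂ) : wedge α (β - β') = wedge α β - wedge α β' := by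
  ext v
  rw [ContinuousAlternatingMap.sub_apply]
  simp only [wedge_apply, sub_apply]
  ring

theorem covector_oneForm {V : Type} [NormedAddCommGroup V] [NormedSpace ℝ V] (α : V →L[ℝ] ℂ) :
    covector (oneForm α) = α :=
  ContinuousLinearMap.ext fun v => covector_apply _ v

theorem contDiffOn_of_isForm_oneForm {W : Set ProjTimes} {ψ : HomCoord → HomCoord →L[ℝ] ℂ}
    (h : IsForm W (fun p => oneForm (ψ p))) : ContDiffOn ℝ ∞ ψ (cone W) := by
  have := contDiff_covector.comp_contDiffOn h.1
  exact this.congr fun p _ => (covector_oneForm (ψ p)).symm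

theorem contDiff_toP : ContDiff ℝ ∞ (toP 0) := contDiff_const.prodMk contDiff_id

theorem covector_pullback_toP (ψ : HomCoord → HomCoord →L[ℝ] ℂ) (x v : ℂ) :
    covector (pullback (toP 0) (fun p => oneForm (ψ p)) x) v = ψ (toP 0 x) (0, v) := by
  rw [covector_apply, pullback_toP_apply]
  rfl

theorem IsRelResidue.contDiff_covector {a : ℂ} {φ : HomCoord → HomCoord [⋀^Fin 2]→L[ℝ] ℂ}
    {ρ : ℂ → ℂ [⋀^Fin 1]→L[ℝ] ℂ} (h : IsRelResidue univ 0 (hypS a) φ ρ) :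
    ContDiff ℝ ∞ fun x => covector (ρ x) := by
  obtain ⟨-, -, σ, -, -, -, W, hW, hP, -, -, ψ, θ, hψ, -, -, hρ⟩ := h
  have e : (fun x => covector (ρ x)) =
      fun x => (ψ (toP 0 x)).comp
        ((0 : ℂ →L[ℝ] (Fin 2 → ℂ)).prod (ContinuousLinearMap.id ℝ ℂ)) := by
    ext x v
    rw [hρ x (mem_univ _), covector_pullback_toP]
    rfl
  rw [e]
  refine ContDiff.clm_comp (contDiff_iff_contDiffAt.2 fun x => ?_) contDiff_const
  exact ((contDiffOn_of_isForm_oneForm hψ).contDiffAt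
    (hW.mem_nhds (toP_mem_cone hP x))).comp x contDiff_toP.contDiffAt

/-- The Poincaré lemma on the convex set ℂ: closedness says that the derivative of the covector
field is symmetric. -/
theorem IsRelResidue.exists_primitive {a : ℂ} {φ : HomCoord → HomCoord [⋀^Fin 2]→L[ℝ] ℂ}
    {ρ : ℂ → ℂ [⋀^Fin 1]→L[ℝ] ℂ} (h : IsRelResidue univ 0 (hypS a) φ ρ) :
    ∃ G : ℂ → ℂ, ∀ x, HasFDerivAt G (covector (ρ x)) x := by
  have hR : Differentiable ℝ fun x => covector (ρ x) := h.contDiff_covector.differentiable (by simp)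
  have e : (fun x => oneForm (covector (ρ x))) = ρ := by
    ext x v
    rw [oneForm_apply, covector_apply]
    congr 1
    ext i
    obtain rfl := Subsingleton.elim i 0
    rfl
  have hρ : Differentiable ℝ ρ := by
    rw [← e]
    exact (contDiff_oneForm.comp h.contDiff_covector).differentiable (by simp)
  obtain ⟨G, hG⟩ := convex_univ.exists_forall_hasFDerivAt_of_fderiv_symmetric isOpen_univ
    hR.differentiableOn (fun x _ v w => by
      have h1 := congrArg (fun τ : ℂ [⋀^Fin 2]→L[ℝ] ℂ => τ ![v, w]) (h.2.1 x (mem_univ x))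
      simp only [extDeriv_one_apply (hρ x), Matrix.cons_val_zero, Matrix.cons_val_one,
        ← covector_apply] at h1
      have h2 : ∀ v, fderiv ℝ (fun x => covector (ρ x) v) x =
          (fderiv ℝ (fun x => covector (ρ x)) x).flip v := fun v => by
        rw [fderiv_clm_apply (hR x) (differentiableAt_const v)]
        simp
      rw [h2, h2] at h1
      exact sub_eq_zero.1 h1)
  exact ⟨G, fun x => hG x (mem_univ x)⟩

/-- Subtracting the two presentations cancels φ, so d(σ - σ') has polar part ψ - ψ' near P and the
tube argument applies on `W ∩ W'`. Its conclusion concerns the segment t ↦ 1 - t from 1 to 0. -/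
theorem IsRelResidue.primitive_sub_eq {a : ℂ} {φ : HomCoord → HomCoord [⋀^Fin 2]→L[ℝ] ℂ}
    {ρ ρ' : ℂ → ℂ [⋀^Fin 1]→L[ℝ] ℂ} (h : IsRelResidue univ 0 (hypS a) φ ρ)
    (h' : IsRelResidue univ 0 (hypS a) φ ρ') {G G' : ℂ → ℂ}
    (hG : ∀ x, HasFDerivAt G (covector (ρ x)) x) (hG' : ∀ x, HasFDerivAt G' (covector (ρ' x)) x) :
    G 0 - G 1 = G' 0 - G' 1 := by
  have hc := h.contDiff_covector.continuous
  have hc' := h'.contDiff_covector.continuous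
  obtain ⟨-, -, σ, hσ, hσQ, hσS, W, hW, hP, -, -, ψ, θ, hψ, hθ, hφ, hρ⟩ := h
  obtain ⟨-, -, σ', hσ', hσQ', hσS', W', hW', hP', -, -, ψ', θ', hψ', hθ', hφ', hρ'⟩ := h'
  have hint : ∫ t in (0 : ℝ)..1, (ψ (toP 0 (1 - t)) - ψ' (toP 0 (1 - t))) (0, -1) = 0 := by
    refine integral_polar_part_eq_zero a (hσ.sub hσ') (hσQ.sub hσQ') (hσS.sub hσS')
      (W := W ∩ W') (ψ := fun p => ψ p - ψ' p) (θ := fun p => θ p - θ' p)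
      (by rw [cone_inter]; exact hW.inter hW') (subset_inter hP hP')
      (by
        rw [cone_inter]
        exact ((contDiffOn_of_isForm_oneForm hψ).continuousOn.mono inter_subset_left).sub
          ((contDiffOn_of_isForm_oneForm hψ').continuousOn.mono inter_subset_right))
      (by
        rw [cone_inter]
        exact (hθ.1.continuousOn.mono inter_subset_left).sub
          (hθ'.1.continuousOn.mono inter_subset_right)) ?_
    rintro p ⟨hp0, ⟨hp, hp'⟩, hpP⟩
    have hpY : p ∈ cone (spaceY univ \ hypP univ 0) := ⟨hp0, mem_univ _, hpP⟩
    rw [extDeriv_fun_sub (differentiableAt_of_isForm hσ isOpen_cone_diff_hypP hpY)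
      (differentiableAt_of_isForm hσ' isOpen_cone_diff_hypP hpY), wedge_sub, smul_sub,
      ← add_sub_add_comm, ← hφ p ⟨hp0, hp, hpP⟩, ← hφ' p ⟨hp0, hp', hpP⟩, add_sub_add_left_eq_sub]
  have hd : ∀ t : ℝ, HasDerivAt (fun t : ℝ => G (1 - t) - G' (1 - t))
      ((ψ (toP 0 (1 - t)) - ψ' (toP 0 (1 - t))) (0, -1)) t := by
    intro t
    have h1 : HasDerivAt (fun t : ℝ => (1 : ℂ) - t) (-1) t :=
      (Complex.ofRealCLM.hasDerivAt (x := t)).const_sub 1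
    have h2 := ((hG (1 - t)).comp_hasDerivAt t h1).sub ((hG' (1 - t)).comp_hasDerivAt t h1)
    rw [hρ _ (mem_univ _), hρ' _ (mem_univ _), covector_pullback_toP, covector_pullback_toP] at h2
    exact h2
  have hcont : Continuous fun t : ℝ => (ψ (toP 0 (1 - t)) - ψ' (toP 0 (1 - t))) (0, -1) := by
    have e : (fun t : ℝ => (ψ (toP 0 (1 - t)) - ψ' (toP 0 (1 - t))) (0, -1)) =
        fun t : ℝ => covector (ρ (1 - t)) (-1) - covector (ρ' (1 - t)) (-1) := by
      ext t
      rw [hρ _ (mem_univ _), hρ' _ (mem_univ _), covector_pullback_toP, covector_pullback_toP]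
      rfl
    rw [e]
    have h1 : Continuous fun t : ℝ => (1 : ℂ) - t := by fun_prop
    exact ((hc.comp h1).clm_apply continuous_const).sub ((hc'.comp h1).clm_apply continuous_const)
  have hftc := intervalIntegral.integral_eq_sub_of_hasDerivAt (fun t _ => hd t)
    (hcont.intervalIntegrable 0 1)
  rw [hint] at hftc
  simp at hftc
  linear_combination -hftc

/-! ### Evaluation of the third formula. -/

/-- The value of a function on a 0-chain. -/
noncomputable def evalChain (G : ℂ → ℂ) : Chain 0 →ₗ[ℂ] ℂ :=
  Finsupp.linearCombination ℂ fun s : Simp 0 => G (s default)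

theorem chainIntegral_eq_evalChain {ρ : ℂ → ℂ [⋀^Fin 1]→L[ℝ] ℂ} {G : ℂ → ℂ}
    (hc : Continuous fun x => covector (ρ x)) (hG : ∀ x, HasFDerivAt G (covector (ρ x)) x)
    {γ : Chain 1} (hγ : γ ∈ chains univ 1) :
    chainIntegral ρ γ = evalChain G (boundary 0 γ) := by
  have e : boundary 0 γ = ∑ s ∈ γ.support, boundary 0 (Finsupp.single s (γ s)) := by
    rw [← map_sum]
    exact congrArg _ γ.sum_single.symm
  rw [e, map_sum]
  refine Finset.sum_congr rfl fun s hs => ?_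
  obtain ⟨f, hf, rfl⟩ := (hγ hs).1.exists_edge
  have hfd := hf.differentiable (by simp)
  have h1 := chainIntegral_single_edge ρ hfd (γ (edge f))
  rw [chainIntegral, Finsupp.sum_single_index (zero_mul _)] at h1
  refine h1.trans ?_
  simp only [← covector_apply]
  rw [intervalIntegral.integral_eq_sub_of_hasDerivAt
    (fun t _ => (hG (f t)).comp_hasDerivAt t (hfd t).hasDerivAt)
    (((hc.comp hf.continuous).clm_apply (hf.continuous_deriv (by simp))).intervalIntegrable 0 1),
    boundary_zero_single, map_sub, evalChain, Finsupp.linearCombination_single,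
    Finsupp.linearCombination_single]
  simp [pointSimp]
  ring

/-- Any primitive of ρ has the same difference between 0 and 1 as `resPrim a f`, whose values there
are f(0) and a f(1). -/
theorem thirdRHS_eq {a : ℂ} {f : ℂ → ℂ} (hf : Differentiable ℂ f) {β : Chain 0} {γ : Chain 1}
    {ρ : ℂ → ℂ [⋀^Fin 1]→L[ℝ] ℂ} (hβ : IsBeta univ 0 β)
    (hγ : InBoundaryPreimage univ 0 (hypS a) β γ)
    (hρ : IsRelResidue univ 0 (hypS a) (formPsi 0 f) ρ) : thirdRHS ρ γ = f 0 - a * f 1 := by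
  obtain rfl := isBeta_iff.1 hβ
  obtain ⟨G, hG⟩ := hρ.exists_primitive
  have hG' : ∀ x, HasFDerivAt (resPrim a f) (covector (oneForm
      ((ContinuousLinearMap.toSpanSingleton ℂ
        (deriv (fun w => f w * ((a - 1) * w + 1)) x)).restrictScalars ℝ))) x := by
    intro x
    rw [covector_oneForm]
    exact ((differentiable_resPrim a hf) x).hasDerivAt.hasFDerivAt.restrictScalars ℝ
  have h1 := hρ.primitive_sub_eq (isRelResidue_formPsi a hf) hG hG'
  rw [thirdRHS, chainIntegral_eq_evalChain hρ.contDiff_covector.continuous hG hγ.1,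
    hγ.boundary_eq, map_sub, evalChain, Finsupp.linearCombination_single,
    Finsupp.linearCombination_single]
  simp only [pointSimp, one_smul, h1, resPrim]
  simp
  ring

theorem thirdFormula_iff {a : ℂ} {f : ℂ → ℂ} (hf : Differentiable ℂ f) :
    ThirdFormula univ 0 (hypS a) f ↔ f 0 = f 0 - a * f 1 := by
  constructor
  · intro h
    have hβ : IsBeta univ 0 _ := isBeta_iff.2 rfl
    have hs : IsSmoothSimp (edge (affinePath 1 0)) := isSmoothSimp_edge (contDiff_affinePath 1 0)
    have hγ := inBoundaryPreimage_single (a := a) hs (by simp [affinePath]) (by simp [affinePath])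
    have hρ := isRelResidue_formPsi a hf
    exact (h _ _ _ hβ hγ hρ).trans (thirdRHS_eq hf hβ hγ hρ)
  · intro h β γ ρ hβ hγ hρ
    rw [thirdRHS_eq hf hβ hγ hρ]
    exact h

theorem forall_thirdFormula_iff {a : ℂ} :
    (∀ f : ℂ → ℂ, Differentiable ℂ f → ThirdFormula univ 0 (hypS a) f) ↔ a = 0 := by
  constructor
  · intro h
    -- The constant function 1 already forces a = 0.
    have := (thirdFormula_iff (differentiable_const (1 : ℂ))).1
      (h (fun _ => 1) (differentiable_const 1))
    linear_combination this
  · rintro rfl f hf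
    rw [thirdFormula_iff hf]
    simp

theorem not_lerayThirdFormula : ¬ LerayThirdFormula := by
  intro h
  have h1 : (1 : ℂ) = 0 := forall_thirdFormula_iff.1 fun f hf =>
    h univ 0 (hypS 1) f isOpen_univ isConnected_univ (mem_univ 0) hf.differentiableOn
      (isSmoothHypersurface_hypS 1) (inGeneralPosition_hypS 1)
  exact one_ne_zero h1

end Leray

theorem mainTheorem2 :
    (∀ a : ℂ,
      -- the data are admissible, and the topological condition holds
      IsSmoothHypersurface univ (hypS a) ∧
      InGeneralPosition univ ![hypP univ 0, hypQ univ, hypS a] ∧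
      (∀ y ∈ hypP univ 0, y.2 = 1 → y ∈ hypS a) ∧
      (∃! β, IsBeta univ 0 β) ∧
      (∀ β, IsBeta univ 0 β →
        (∀ s : Simp 1, IsSmoothSimp s → s (edgePoint 0) = 1 → s (edgePoint 1) = 0 →
          InBoundaryPreimage univ 0 (hypS a) β (Finsupp.single s 1)) ∧
        (∀ γ γ', InBoundaryPreimage univ 0 (hypS a) β γ → InBoundaryPreimage univ 0 (hypS a) β γ' →
          RelHomologous univ 0 (hypS a) γ γ')) ∧
      -- the formula for a given function
      (∀ f : ℂ → ℂ, Differentiable ℂ f →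
        IsRelResidue univ 0 (hypS a) (formPsi 0 f)
          (fun x => oneForm ((ContinuousLinearMap.toSpanSingleton ℂ
            (deriv (fun w => f w * ((a - 1) * w + 1)) x)).restrictScalars ℝ)) ∧
        (∀ β γ ρ, IsBeta univ 0 β → InBoundaryPreimage univ 0 (hypS a) β γ →
          IsRelResidue univ 0 (hypS a) (formPsi 0 f) ρ → thirdRHS ρ γ = f 0 - a * f 1) ∧
        (ThirdFormula univ 0 (hypS a) f ↔ f 0 = f 0 - a * f 1) ∧
        (a ≠ 0 → f 1 ≠ 0 → ¬ ThirdFormula univ 0 (hypS a) f)) ∧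
      ((∀ f : ℂ → ℂ, Differentiable ℂ f → ThirdFormula univ 0 (hypS a) f) ↔ a = 0)) ∧
    ¬ LerayThirdFormula := by
  refine ⟨fun a => ⟨isSmoothHypersurface_hypS a, inGeneralPosition_hypS a,
    fun y => mem_hypS_of_mem_hypP, ⟨_, isBeta_iff.2 rfl, fun β => isBeta_iff.1⟩, fun β hβ => ?_,
    fun f hf => ⟨isRelResidue_formPsi a hf, fun β γ ρ => thirdRHS_eq hf, thirdFormula_iff hf,
      fun ha hf1 h => ?_⟩, forall_thirdFormula_iff⟩, not_lerayThirdFormula⟩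
  · obtain rfl := isBeta_iff.1 hβ
    exact ⟨fun s => inBoundaryPreimage_single, fun γ γ' => InBoundaryPreimage.relHomologous⟩
  · have h1 := (thirdFormula_iff hf).1 h
    exact mul_ne_zero ha hf1 (by linear_combination h1)
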